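/- For real $c>0$ and $n\ge c$ let $A(G(n,c/n))$ be the adjacency matrix of the Erdős–Rényi (binomial) random graph on $n$ labelled vertices with edge probability $c/n$. Let $p(x)=\sum_{i\ge 0}x^i$ and, for $c>1$, let $\mu_n^p=\frac1n\sum_{\lambda}\delta_\lambda$, where $\lambda$ runs over the eigenvalues (with multiplicity) of $(c\,p(1/c))^{-1/2}A(G(n,c/n))$. Write $m_k(\mu_n^p)$ for its expected $k$-th moment and $m_k(\mu^p)=\lim_{n\to\infty}m_k(\mu_n^p)$. Let $w_{m,2\ell}$ be the number of tree walks of length $2\ell$ and size $m$, i.e. of closed walks of length $2\ell$ on the complete graph with vertex set $\{1,\dots,m\}$ that visit every vertex and whose traversed edges form a tree ($w_{1,0}=1$, $w_{0,2\ell}=0$). Let $$M_{\mu^c}(\sqrt z)=\sum_{\ell\ge0}\sum_{m=0}^{\ell+1}\frac{w_{m,2\ell}}{m!}c^{m-\ell-1}z^\ell,\qquad M_{\mu^p}(\sqrt z)=M_{\mu^c}\Big(\sqrt{z/p(1/c)}\Big),\qquad \hat V_i(z)=[c^{-i}]\,M_{\mu^p}(\sqrt z),$$ as formal power series in $z$ and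 $1/c$, and let $C(z)=\frac{1-\sqrt{1-4z}}{2z}$ be the generating function of the Catalan numbers. (a) $M_{\mu^p}$ is the generating function of the moments of $\mu^p$: for every real $c>1$ and every $\ell\ge0$ the limits defining $m_{2\ell}(\mu^p)$ and $m_{2\ell+1}(\mu^p)$ exist, $m_{2\ell+1}(\mu^p)=0$, and $m_{2\ell}(\mu^p)=\sum_{i\ge0}c^{-i}\,[z^\ell]\hat V_i(z)$. (b) For $i=0,1,2$ there is a polynomial $\hat Q_i\in\mathbb Q[x]$ with $\hat V_i(z)=C(z)\,\hat Q_i\big(zC(z)^2\big)$. (c) For every $i\ge3$ there is a polynomial $\hat Q_i\in\mathbb Q[x]$ with $$\hat V_i(z)=C(z)\,\frac{\hat Q_i\big(zC(z)^2\big)}{\big(1-zC(z)^2\big)^{2i-3}}.$$ -/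

import Mathlib

open scoped Topology PowerSeries SimpleGraph Nat Polynomial
open Filter

noncomputable section

namespace TreeWalk

/-! ### The random matrix model -/

/-- The adjacency matrix of `G` multiplied by the real number `s`. -/
def scaledAdj {n : ℕ} (s : ℝ) (G : SimpleGraph (Fin n)) : Matrix (Fin n) (Fin n) ℝ :=
  open Classical in s • G.adjMatrix ℝ

theorem scaledAdj_isHermitian {n : ℕ} (s : ℝ) (G : SimpleGraph (Fin n)) :
    (scaledAdj s G).IsHermitian := by
  classical
  ext i j
  simp [scaledAdj, SimpleGraph.adjMatrix_apply, SimpleGraph.adj_comm]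

/-- The `k`-th moment of the uniform probability measure on the spectrum (with multiplicity)
of `s • A(G)`: `(1/n) ∑_{λ ∈ Sp(s A(G))} λ ^ k`. -/
def spectralMoment {n : ℕ} (s : ℝ) (G : SimpleGraph (Fin n)) (k : ℕ) : ℝ :=
  (1 / (n : ℝ)) * ∑ j, (scaledAdj_isHermitian s G).eigenvalues j ^ k

/-- The edge probability `c / n` (for `0 ≤ c ≤ n`; clamped to `[0, 1]` otherwise). -/
def edgeProb (c : ℝ) (n : ℕ) : unitInterval := Set.projIcc 0 1 zero_le_one (c / n)

/-- The value at the real number `x` of a power series with rational coefficients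
(where it converges). -/
def evalReal (p : ℚ⟦X⟧) (x : ℝ) : ℝ := ∑' i, ((PowerSeries.coeff i p : ℚ) : ℝ) * x ^ i

/-- The `k`-th moment of `μ_n ^ p`, the normalized spectral measure of the matrix
`(c p(1/c)) ^ (-1/2) A(G(n, c/n))`, that is
`∑_G ℙ[G(n, c/n) = G] (1/n) ∑_λ λ ^ k`, with `λ` in the spectrum of
`(c p(1/c)) ^ (-1/2) A(G)`. -/
def randomMoment (p : ℚ⟦X⟧) (c : ℝ) (n k : ℕ) : ℝ :=
  ∑ G : SimpleGraph (Fin n),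
    (SimpleGraph.binomialRandom (Fin n) (edgeProb c n)).real {G} *
      spectralMoment ((c * evalReal p (1 / c)) ^ (-(1 / 2) : ℝ)) G k

/-! ### Tree walks and the moment generating function -/

/-- The number of tree walks of length `len` that span a tree of size `m`: closed walks on the
complete graph with vertex set `Fin m` that visit every vertex and
whose traversed edges form a tree. -/
def numTreeWalks (m len : ℕ) : ℕ :=
  Nat.card {W : (Σ u : Fin m, (⊤ : SimpleGraph (Fin m)).Walk u u) //
    W.2.length = len ∧ (∀ x, x ∈ W.2.support) ∧ W.2.toSubgraph.spanningCoe.IsTree}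

/-- The moment of order `2 ℓ` of `μ ^ c`, as a polynomial in the formal variable `x = 1 / c`:
`∑_{m = 0}^{ℓ + 1} (w_{m, 2 ℓ} / m!) x ^ (ℓ + 1 - m)`. -/
def formalMoment (l : ℕ) : ℚ⟦X⟧ :=
  ∑ m ∈ Finset.range (l + 2),
    PowerSeries.monomial (l + 1 - m) ((numTreeWalks m (2 * l) : ℚ) / (m ! : ℚ))

/-- `M_{μ ^ c}(√z)`, a power series in `z` with coefficients in `ℚ⟦x⟧`, `x = 1 / c`. -/
def momentGF : ℚ⟦X⟧⟦X⟧ := PowerSeries.mk formalMoment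

/-- `M_{μ ^ p}(√z) = M_{μ ^ c}(√(z / p(1/c)))`, for a scaling series `p` with `p(0) ≠ 0`. -/
def scaledMomentGF (p : ℚ⟦X⟧) : ℚ⟦X⟧⟦X⟧ := PowerSeries.rescale p⁻¹ momentGF

/-- `[c ^ (-i)] M_{μ ^ p}(√z)`, a power series in `z`. -/
def coeffGF (p : ℚ⟦X⟧) (i : ℕ) : ℚ⟦X⟧ :=
  PowerSeries.mk fun l => PowerSeries.coeff i (PowerSeries.coeff l (scaledMomentGF p))

/-- The scaling `p(x) = ∑_{i ≥ 0} x ^ i`. -/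
def geomScaling : ℚ⟦X⟧ := PowerSeries.mk fun _ => 1

/-- The generating function `C(z)` of the Catalan numbers. -/
def catGF : ℚ⟦X⟧ := PowerSeries.mk fun n => (catalan n : ℚ)

/-- The power series `z C(z) ^ 2`. -/
def zCsq : ℚ⟦X⟧ := PowerSeries.X * catGF ^ 2

end TreeWalk

end

/-! A closed walk in a rooted tree is a sequence of excursions to children of the root, so tree
walks are labelled plane trees. Counting single walks gives no closed recursion: below a child
visited `s + 1` times one finds an `(s + 1)`-tuple of closed walks that jointly span a subtree.
Hence let `f_k` (`walkGF k`) count `k`-tuples of closed walks from a common root that span one tree,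
with `z` marking half the total length and `x = 1/c` its excess over the number of edges. Splitting
off the first child of the root (`excursionGF_succ`, `coeff_walkGF_succ`) gives `f_0 = 1` and
`f_{k+1} = f_k + ∑_s binom(k+s, s) z^(s+1) x^s f_{s+1} f_{k+1+s}`, and `f_1` is the moment series
(`momentGF_eq_walkGF`).

The scaling replaces `z` by `Z = z (1 - x)`. Put `y = z C(z)^2`, `B = 1 - Z f_1`, `1 / B = C a`,
`g_k = f_k B^k` and `w = Z / B^2`. This absorbs the term `s = 0`, and all other terms carry a factor
`x`; so the coefficients of `g_k` arise from earlier ones without division (`NormalizedSystem`).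
Division enters only through `a`: with `a = 1 + x β` and `g_1 = 1 + x h`, the relation `(1 + y) a =
1 + w g_1` becomes `(1 - y) β = y (x β^2 + a^2 (h - 1 - x h))` (`NormalizedSystem.quadratic`). Each
order in `x` thus costs at most one factor `1 - y`, and the first two divisions are exact
(`NormalizedSystem.first_coeffs`). So the coefficient of `x^i` in `f_1 = C a g_1` is `C` times a
polynomial in `y` over `(1 - y)^(i - 2)`, with no denominator for `i ≤ 2`; for `i ≥ 3` this is
stronger than required.

For the moments, the trace formula and independence of the edges turn the expectation into a sum
over closed words, weighted by `(c/n)^e` for `e` distinct edges. There are of order `n^m` words on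
`m` vertices, and connectedness forces `m ≤ e + 1`, so after division by `n` only trees survive in
the limit (`tendsto_randomMoment`). The limit is a polynomial in `1/c`, so the series over `i` is
finite. -/

noncomputable section

namespace TreeWalk

/-! ### Labelled plane trees -/

/-- Closed walks in a rooted tree, coded as labelled plane trees: a closed walk at `v` is either
trivial, or it makes an excursion to `u`, performs a closed walk `d` there, comes back to `v`, and
continues with a closed walk `r` at `v`. -/
inductive PlaneTree (V : Type) : Type
  | nil : PlaneTree V
  | cons (u : V) (d r : PlaneTree V) : PlaneTree V

namespace PlaneTree

variable {V : Type}

/-- The number of excursions, i.e. half of the length of the walk. -/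
def size : PlaneTree V → ℕ
  | nil => 0
  | cons _ d r => d.size + 1 + r.size

/-- The vertices visited, apart from the root. -/
def labels : PlaneTree V → Set V
  | nil => ∅
  | cons u d r => insert u (d.labels ∪ r.labels)

/-- The labelled plane tree `t` with root `v` maps to the rooted forest with parent function `π`
and height function `h`. -/
def Respects (π : V → V) (h : V → ℤ) : V → PlaneTree V → Prop
  | _, nil => True
  | v, cons u d r => (π u = v ∧ h u = h v + 1) ∧ Respects π h u d ∧ Respects π h v r

/-- A single excursion. -/
def excursion (p : V × PlaneTree V) : PlaneTree V := cons p.1 p.2 nil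

/-- Height measures depth: the height difference tells how often the parent map must be applied to
climb from a label back to the root. This is how acyclicity is used throughout. -/
theorem Respects.exists_iterate {π : V → V} {h : V → ℤ} {v x : V} {t : PlaneTree V}
    (ht : Respects π h v t) (hx : x ∈ t.labels) :
    ∃ n : ℕ, h x = h v + n + 1 ∧ π^[n + 1] x = v := by
  induction t generalizing v with
  | nil => simp [labels] at hx
  | cons u d r ihd ihr =>
    obtain ⟨⟨h1, h2⟩, h3, h4⟩ := ht
    rcases hx with rfl | hx | hx
    · exact ⟨0, by simp [h2], by simp [h1]⟩
    · obtain ⟨n, h5, h6⟩ := ihd h3 hx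
      refine ⟨n + 1, by push_cast; omega, ?_⟩
      rw [Function.iterate_succ_apply', h6, h1]
    · exact ihr h4 hx

theorem Respects.root_notMem {π : V → V} {h : V → ℤ} {v : V} {t : PlaneTree V}
    (ht : Respects π h v t) : v ∉ t.labels := fun hx => by
  obtain ⟨n, h1, -⟩ := ht.exists_iterate hx
  omega

/-- Subtrees hanging from different vertices of equal height have no vertex in common. -/
theorem Respects.eq_of_mem {π : V → V} {h : V → ℤ} {u u' x : V} {t t' : PlaneTree V}
    (ht : Respects π h u t) (ht' : Respects π h u' t') (hu : h u = h u')
    (hx : x = u ∨ x ∈ t.labels) (hx' : x = u' ∨ x ∈ t'.labels) : u = u' := by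
  have key : ∀ {w : V} {s : PlaneTree V}, Respects π h w s → (x = w ∨ x ∈ s.labels) →
      ∃ n : ℕ, h x = h w + n ∧ π^[n] x = w := by
    rintro w s hs (rfl | hx)
    · exact ⟨0, by simp, rfl⟩
    · obtain ⟨n, h1, h2⟩ := hs.exists_iterate hx
      exact ⟨n + 1, by push_cast; omega, h2⟩
  obtain ⟨n, h1, h2⟩ := key ht hx
  obtain ⟨n', h1', h2'⟩ := key ht' hx'
  -- Both counts equal the same height difference, so `u` and `u'` are the same iterate of `x`.
  obtain rfl : n = n' := by omega
  exact h2.symm.trans h2'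

/-- Only values on the labels matter, and heights only up to a common shift `c`; this allows a
subtree to be hung at another level when families are glued. -/
theorem Respects.congr {π π' : V → V} {h h' : V → ℤ} {c : ℤ} {v : V} {t : PlaneTree V}
    (ht : Respects π h v t) (hπ : ∀ x ∈ t.labels, π' x = π x)
    (hh : ∀ x ∈ t.labels, h' x = h x + c) (hv : h' v = h v + c) : Respects π' h' v t := by
  induction t generalizing v with
  | nil => trivial
  | cons u d r ihd ihr =>
    obtain ⟨⟨h1, h2⟩, h3, h4⟩ := ht
    have hu : h' u = h u + c := hh u (Or.inl rfl)
    refine ⟨⟨?_, by omega⟩, ihd h3 (fun x hx => hπ x (Or.inr (Or.inl hx)))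
      (fun x hx => hh x (Or.inr (Or.inl hx))) hu, ihr h4 (fun x hx => hπ x (Or.inr (Or.inr hx)))
      (fun x hx => hh x (Or.inr (Or.inr hx))) hv⟩
    rw [hπ u (Or.inl rfl), h1]

theorem finite_labels_size (S : Finset V) (l : ℕ) :
    {t : PlaneTree V | t.labels ⊆ S ∧ t.size ≤ l}.Finite := by
  induction l with
  | zero =>
    refine (Set.finite_singleton nil).subset ?_
    rintro (_ | ⟨u, d, r⟩) ⟨-, h⟩
    · rfl
    · simp [size] at h
  | succ l ih =>
    refine ((Set.finite_singleton nil).union ((S.finite_toSet.prod (ih.prod ih)).image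
      (fun p => cons p.1 p.2.1 p.2.2))).subset ?_
    rintro (_ | ⟨u, d, r⟩) ⟨h1, h2⟩
    · exact Or.inl rfl
    · refine Or.inr ⟨(u, d, r), ⟨h1 (Or.inl rfl), ⟨fun x hx => h1 (Or.inr (Or.inl hx)), ?_⟩,
        ⟨fun x hx => h1 (Or.inr (Or.inr hx)), ?_⟩⟩, rfl⟩ <;>
      · simp only [size] at h2 ⊢
        omega

end PlaneTree

/-! ### Spanning families and their decomposition by the first child -/

open PlaneTree

/-- The family `t` of closed walks at `v`, of total length `2 * l`, spans a tree with vertex set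
`insert v S`. -/
structure Spans {V K : Type} [Fintype K] (v : V) (S : Finset V) (l : ℕ)
    (t : K → PlaneTree V) : Prop where
  respects : ∃ (π : V → V) (h : V → ℤ), ∀ k, Respects π h v (t k)
  mem_iff : ∀ x, x ∈ S ↔ ∃ k, x ∈ (t k).labels
  sum_size : ∑ k, (t k).size = l

/-- The families, indexed by `K`, of closed walks at `v` that span a tree on `insert v S`. -/
def walkFamilies {V : Type} (K : Type) [Fintype K] (v : V) (S : Finset V) (l : ℕ) :
    Set (K → PlaneTree V) :=
  {t | Spans v S l t}

/-- The families, indexed by `I`, of excursions from `v` that span a tree on `insert v S`. -/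
def excursionFamilies {V : Type} (I : Type) [Fintype I] (v : V) (S : Finset V) (l : ℕ) :
    Set (I → V × PlaneTree V) :=
  {e | Spans v S l fun i => excursion (e i)}

section

variable {V K I : Type} {v : V} {S : Finset V} {l : ℕ}

theorem finite_walkFamilies [Fintype K] : (walkFamilies K v S l).Finite := by
  refine (Set.Finite.pi' fun _ : K => finite_labels_size S l).subset fun t ht k =>
    ⟨fun x hx => (ht.mem_iff x).2 ⟨k, hx⟩, ?_⟩
  rw [← ht.sum_size]
  exact Finset.single_le_sum (f := fun k => (t k).size) (fun _ _ => Nat.zero_le _)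
    (Finset.mem_univ k)

theorem excursion_injective : Function.Injective (excursion : V × PlaneTree V → PlaneTree V) := by
  rintro ⟨u, d⟩ ⟨u', d'⟩ h
  simpa [excursion] using h

theorem finite_excursionFamilies [Fintype I] : (excursionFamilies I v S l).Finite :=
  Set.Finite.preimage (f := fun (e : I → V × PlaneTree V) i => excursion (e i))
    (excursion_injective.comp_left.injOn) (finite_walkFamilies (K := I))

open Classical in
/-- Glue a family of closed walks at `u`, indexed by `A`, and a family of excursions, indexed by
the complement of `A`, into a family of excursions. -/
def glue (A : Finset I) (u : V)
    (p : ({i // i ∈ A} → PlaneTree V) × ({i // ¬ i ∈ A} → V × PlaneTree V)) :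
    I → V × PlaneTree V :=
  fun i => if h : i ∈ A then (u, p.1 ⟨i, h⟩) else p.2 ⟨i, h⟩

theorem glue_of_mem {A : Finset I} {u : V}
    {p : ({i // i ∈ A} → PlaneTree V) × ({i // ¬ i ∈ A} → V × PlaneTree V)}
    (i : {i // i ∈ A}) : glue A u p i = (u, p.1 i) := by
  simp [glue]

theorem glue_of_notMem {A : Finset I} {u : V}
    {p : ({i // i ∈ A} → PlaneTree V) × ({i // ¬ i ∈ A} → V × PlaneTree V)}
    (i : {i // ¬ i ∈ A}) : glue A u p i = p.2 i := by
  simp [glue, i.2]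

theorem glue_injective (A : Finset I) (u : V) : Function.Injective (glue A u) := by
  rintro p q hpq
  refine Prod.ext (funext fun i => ?_) (funext fun i => ?_)
  · have := congrFun hpq i
    rw [glue_of_mem, glue_of_mem] at this
    exact congrArg Prod.snd this
  · have := congrFun hpq i
    rwa [glue_of_notMem, glue_of_notMem] at this

theorem sum_size_excursion [Fintype I] (e : I → V × PlaneTree V) :
    ∑ i, (excursion (e i)).size = ∑ i, (e i).2.size + Fintype.card I := by
  simp [excursion, size, Finset.sum_add_distrib]

theorem mem_labels_excursion {x : V} {p : V × PlaneTree V} :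
    x ∈ (excursion p).labels ↔ x = p.1 ∨ x ∈ p.2.labels := by
  simp [excursion, labels]

theorem respects_excursion {π : V → V} {h : V → ℤ} {p : V × PlaneTree V} :
    Respects π h v (excursion p) ↔
      (π p.1 = v ∧ h p.1 = h v + 1) ∧ Respects π h p.1 p.2 := by
  simp [excursion, Respects]

theorem sum_size_glue [Fintype I] [DecidableEq I] (A : Finset I) (u : V)
    (p : ({i // i ∈ A} → PlaneTree V) × ({i // ¬ i ∈ A} → V × PlaneTree V)) :
    ∑ i, (excursion (glue A u p i)).size =
      ∑ i, (p.1 i).size + A.card + ∑ i, (excursion (p.2 i)).size := by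
  rw [← Fintype.sum_subtype_add_sum_subtype (fun i => i ∈ A)]
  congr 1
  · simp only [glue_of_mem, excursion, size, add_zero, Finset.sum_add_distrib]
    rw [← Finset.sum_subtype A (fun _ => Iff.rfl) fun _ => 1, ← Finset.card_eq_sum_ones]
    convert rfl
  · simp [glue_of_notMem]

theorem Spans.glue [Fintype I] [DecidableEq V] [DecidableEq I] {A : Finset I} {u : V}
    {S₁ : Finset V}
    {l₁ l₂ : ℕ} {p : ({i // i ∈ A} → PlaneTree V) × ({i // ¬ i ∈ A} → V × PlaneTree V)}
    (hA : A.Nonempty) (hS : S₁ ⊆ S) (hu : u ∈ S₁) (hv : v ∉ S)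
    (h₁ : Spans u (S₁.erase u) l₁ p.1) (h₂ : Spans v (S \ S₁) l₂ fun i => excursion (p.2 i)) :
    Spans v S (l₁ + A.card + l₂) fun i => excursion (glue A u p i) := by
  obtain ⟨i₀, hi₀⟩ := hA
  obtain ⟨π₁, h₁', hr₁⟩ := h₁.respects
  obtain ⟨π₂, h₂', hr₂⟩ := h₂.respects
  have hvS₁ : v ∉ S₁ := fun h => hv (hS h)
  -- The subtree at `u` keeps its parents, `u` is hung on `v`, and heights on `S₁` are shifted so
  -- that `u` lies exactly one level from `v`.
  refine ⟨⟨fun x => if x = u then v else if x ∈ S₁ then π₁ x else π₂ x,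
    fun x => if x ∈ S₁ then h₁' x + (h₂' v + 1 - h₁' u) else h₂' x, fun i => ?_⟩, fun x => ?_, ?_⟩
  · by_cases hi : i ∈ A
    · rw [glue_of_mem ⟨i, hi⟩, respects_excursion]
      refine ⟨⟨by simp, by simp [hu, hvS₁]⟩, (hr₁ ⟨i, hi⟩).congr (c := h₂' v + 1 - h₁' u)
        (fun x hx => ?_) (fun x hx => ?_) (by simp [hu])⟩
      all_goals
        have := (h₁.mem_iff x).2 ⟨_, hx⟩
        rw [Finset.mem_erase] at this
        simp [this]
    · rw [glue_of_notMem ⟨i, hi⟩]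
      refine (hr₂ ⟨i, hi⟩).congr (c := 0) (fun x hx => ?_) (fun x hx => ?_) (by simp [hvS₁])
      all_goals
        have := (h₂.mem_iff x).2 ⟨_, hx⟩
        rw [Finset.mem_sdiff] at this
        have hxu : x ≠ u := fun h => this.2 (h ▸ hu)
        simp [this, hxu]
  · constructor
    · intro hx
      by_cases hx1 : x ∈ S₁
      · by_cases hxu : x = u
        · refine ⟨i₀, ?_⟩
          rw [glue_of_mem ⟨i₀, hi₀⟩, mem_labels_excursion]
          exact Or.inl hxu
        · obtain ⟨i, hi⟩ := (h₁.mem_iff x).1 (Finset.mem_erase.2 ⟨hxu, hx1⟩)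
          refine ⟨i, ?_⟩
          rw [glue_of_mem i, mem_labels_excursion]
          exact Or.inr hi
      · obtain ⟨i, hi⟩ := (h₂.mem_iff x).1 (Finset.mem_sdiff.2 ⟨hx, hx1⟩)
        refine ⟨i, ?_⟩
        rwa [glue_of_notMem i]
    · rintro ⟨i, hi⟩
      by_cases hiA : i ∈ A
      · rw [glue_of_mem ⟨i, hiA⟩, mem_labels_excursion] at hi
        rcases hi with hi | hi
        · exact hS (hi ▸ hu)
        · exact hS (Finset.mem_of_mem_erase ((h₁.mem_iff x).2 ⟨_, hi⟩))
      · rw [glue_of_notMem ⟨i, hiA⟩] at hi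
        exact (Finset.mem_sdiff.1 ((h₂.mem_iff x).2 ⟨_, hi⟩)).1
  · rw [sum_size_glue, h₁.sum_size, h₂.sum_size]

/-- The same parent and height functions serve both parts. The point is disjointness: an excursion
to another child cannot meet `S₁`, by `Respects.eq_of_mem`. -/
theorem Spans.of_glue [Fintype I] [DecidableEq V] [DecidableEq I] {A : Finset I} {u : V}
    {S₁ : Finset V}
    {p : ({i // i ∈ A} → PlaneTree V) × ({i // ¬ i ∈ A} → V × PlaneTree V)}
    (hA : A.Nonempty) (h : Spans v S l fun i => excursion (TreeWalk.glue A u p i))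
    (hp : ∀ i, (p.2 i).1 ≠ u)
    (hS₁ : ∀ x, x ∈ S₁ ↔ x = u ∨ ∃ i, x ∈ (p.1 i).labels) :
    Spans u (S₁.erase u) (∑ i, (p.1 i).size) p.1 ∧
      Spans v (S \ S₁) (∑ i, (excursion (p.2 i)).size) fun i => excursion (p.2 i) := by
  obtain ⟨π, ht, hr⟩ := h.respects
  have hr₁ : ∀ i, (π u = v ∧ ht u = ht v + 1) ∧ Respects π ht u (p.1 i) := fun i => by
    have := hr i
    rwa [glue_of_mem, respects_excursion] at this
  have hr₂ : ∀ i, Respects π ht v (excursion (p.2 i)) := fun i => by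
    have := hr i
    rwa [glue_of_notMem] at this
  refine ⟨⟨⟨π, ht, fun i => (hr₁ i).2⟩, fun x => ?_, rfl⟩, ⟨⟨π, ht, hr₂⟩, fun x => ?_, rfl⟩⟩
  · rw [Finset.mem_erase, hS₁]
    constructor
    · rintro ⟨h1, h2 | h2⟩
      · exact absurd h2 h1
      · exact h2
    · rintro ⟨i, hi⟩
      refine ⟨?_, Or.inr ⟨i, hi⟩⟩
      rintro rfl
      exact (hr₁ i).2.root_notMem hi
  · rw [Finset.mem_sdiff, h.mem_iff, hS₁]
    constructor
    · rintro ⟨⟨i, hi⟩, h2⟩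
      by_cases hiA : i ∈ A
      · rw [glue_of_mem ⟨i, hiA⟩, mem_labels_excursion] at hi
        exact absurd (hi.imp_right fun h => ⟨_, h⟩) h2
      · rw [glue_of_notMem ⟨i, hiA⟩] at hi
        exact ⟨_, hi⟩
    · rintro ⟨i, hi⟩
      refine ⟨⟨i, by rwa [glue_of_notMem i]⟩, ?_⟩
      have h3 := respects_excursion.1 (hr₂ i)
      rw [mem_labels_excursion] at hi
      rintro hx
      obtain ⟨i₀, hi₀⟩ := hA
      have : ∃ j : {i // i ∈ A}, x = u ∨ x ∈ (p.1 j).labels := by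
        rcases hx with hx | ⟨j', hj'⟩
        · exact ⟨⟨i₀, hi₀⟩, Or.inl hx⟩
        · exact ⟨j', Or.inr hj'⟩
      obtain ⟨j', hj'⟩ := this
      exact hp i (h3.2.eq_of_mem (hr₁ j').2 (by rw [h3.1.2, (hr₁ j').1.2]) hi hj')

theorem ncard_eq_sum_ncard_fiber {α β : Type} {s : Set α} (hs : s.Finite) (f : α → β)
    (t : Finset β) (hf : ∀ a ∈ s, f a ∈ t) :
    s.ncard = ∑ b ∈ t, {a | a ∈ s ∧ f a = b}.ncard := by
  classical
  rw [Set.ncard_eq_toFinset_card s hs,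
    Finset.card_eq_sum_card_fiberwise (f := f) (t := t) (fun a ha => hf a (by simpa using ha))]
  refine Finset.sum_congr rfl fun b _ => ?_
  rw [← Set.ncard_coe_finset]
  congr 1
  ext a
  simp

open Classical in
/-- The data of the first child of the root in a family of excursions: the excursions that go to
that child, the set of vertices reached by those, the child, and their length. -/
def firstChildData [Fintype I] [DecidableEq V] (S : Finset V) (i₀ : I) (e : I → V × PlaneTree V) :
    (Finset I × (Σ _ : Finset V, V)) × ℕ :=
  ((Finset.univ.filter fun i => (e i).1 = (e i₀).1,
    ⟨S.filter fun x => x = (e i₀).1 ∨ ∃ i, (e i).1 = (e i₀).1 ∧ x ∈ (e i).2.labels, (e i₀).1⟩),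
    ∑ i with (e i).1 = (e i₀).1, (e i).2.size)

/-- Once the data of the first child are fixed, the walks below it and the excursions to other
children can be chosen independently. The bound `hl` makes the truncated subtraction of lengths
exact. -/
theorem firstChildData_fiber [Fintype I] [DecidableEq V] [DecidableEq I] (hv : v ∉ S) {i₀ : I}
    {A : Finset I} (hA : i₀ ∈ A) {S₁ : Finset V} (hS : S₁ ⊆ S) {u : V} (hu : u ∈ S₁) {l₁ : ℕ}
    (hl : l₁ + A.card ≤ l) :
    {e | e ∈ excursionFamilies I v S l ∧ firstChildData S i₀ e = ((A, ⟨S₁, u⟩), l₁)} =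
      TreeWalk.glue A u '' (walkFamilies {i // i ∈ A} u (S₁.erase u) l₁ ×ˢ
        excursionFamilies {i // ¬ i ∈ A} v (S \ S₁) (l - A.card - l₁)) := by
  classical
  ext e
  constructor
  · rintro ⟨he, hd⟩
    simp only [firstChildData, Prod.mk.injEq] at hd
    obtain ⟨⟨hA', hS'⟩, hl'⟩ := hd
    obtain ⟨hS'', hu'⟩ := Sigma.mk.inj_iff.1 hS'
    obtain rfl := eq_of_heq hu'
    have hmem : ∀ i, i ∈ A ↔ (e i).1 = (e i₀).1 := fun i => by simp [← hA']
    have hglue : TreeWalk.glue A (e i₀).1 (fun i => (e i).2, fun i => e i) = e := by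
      funext i
      by_cases hi : i ∈ A
      · rw [glue_of_mem ⟨i, hi⟩]
        exact Prod.ext ((hmem i).1 hi).symm rfl
      · rw [glue_of_notMem ⟨i, hi⟩]
    have hsum : ∑ i : {i // i ∈ A}, (e i).2.size = l₁ := by
      rw [← hl', hA', ← Finset.sum_subtype A (fun _ => Iff.rfl) fun i => (e i).2.size]
    have h := he
    rw [← hglue] at h
    have h' := h.of_glue ⟨i₀, hA⟩ (S₁ := S₁) (fun i hi => i.2 ((hmem i).2 hi)) fun x => by
      rw [← hS'', Finset.mem_filter]
      constructor
      · rintro ⟨-, hx | ⟨i, hi, hx⟩⟩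
        · exact Or.inl hx
        · exact Or.inr ⟨⟨i, (hmem i).2 hi⟩, hx⟩
      · rintro (hx | ⟨i, hx⟩)
        · exact ⟨(he.mem_iff x).2 ⟨i₀, by rw [mem_labels_excursion]; exact Or.inl hx⟩, Or.inl hx⟩
        · exact ⟨(he.mem_iff x).2 ⟨i, by rw [mem_labels_excursion]; exact Or.inr hx⟩,
            Or.inr ⟨i, (hmem i).1 i.2, hx⟩⟩
    refine ⟨_, ⟨?_, ?_⟩, hglue⟩
    · have := h'.1
      rwa [hsum] at this
    · have h1 := h.sum_size
      rw [sum_size_glue, hsum] at h1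
      have h2 := h'.2
      have h3 : ∑ i : {i // ¬ i ∈ A}, (excursion (e i)).size = l - A.card - l₁ := by
        simp only at h1
        omega
      rwa [h3] at h2
  · rintro ⟨p, ⟨h₁, h₂⟩, rfl⟩
    have h₁ : Spans u (S₁.erase u) l₁ p.1 := h₁
    have h₂ : Spans v (S \ S₁) _ fun i => excursion (p.2 i) := h₂
    have h := Spans.glue ⟨i₀, hA⟩ hS hu hv h₁ h₂
    rw [show l₁ + A.card + (l - A.card - l₁) = l by omega] at h
    -- No remaining excursion ends at `u`, since `u` is not in `S \ S₁`; so `A` can be read off the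
    -- glued family.
    have hne : ∀ i, (p.2 i).1 ≠ u := fun i hi => by
      have : u ∈ S \ S₁ := (h₂.mem_iff u).2 ⟨i, mem_labels_excursion.2 (Or.inl hi.symm)⟩
      exact (Finset.mem_sdiff.1 this).2 hu
    have hu₀ : TreeWalk.glue A u p i₀ = (u, p.1 ⟨i₀, hA⟩) := glue_of_mem ⟨i₀, hA⟩
    have hmem : ∀ i, (TreeWalk.glue A u p i).1 = u ↔ i ∈ A := fun i => by
      by_cases hi : i ∈ A
      · simp [glue_of_mem ⟨i, hi⟩, hi]
      · simp [glue_of_notMem ⟨i, hi⟩, hi, hne]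
    have hfst : (TreeWalk.glue A u p i₀).1 = u := by rw [hu₀]
    refine ⟨h, Prod.ext (Prod.ext ?_ (Sigma.ext ?_ (heq_of_eq hfst))) ?_⟩
    · ext i
      simp [firstChildData, hfst, hmem]
    · ext x
      simp only [firstChildData]
      rw [Finset.mem_filter, hfst]
      constructor
      · rintro ⟨-, hx | ⟨i, hi, hx⟩⟩
        · exact hx ▸ hu
        · rw [glue_of_mem ⟨i, (hmem i).1 hi⟩] at hx
          exact Finset.mem_of_mem_erase ((h₁.mem_iff x).2 ⟨_, hx⟩)
      · intro hx
        refine ⟨hS hx, ?_⟩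
        by_cases hxu : x = u
        · exact Or.inl hxu
        · obtain ⟨i, hi⟩ := (h₁.mem_iff x).1 (Finset.mem_erase.2 ⟨hxu, hx⟩)
          refine Or.inr ⟨i, (hmem i).2 i.2, ?_⟩
          rwa [glue_of_mem i]
    · simp only [firstChildData, hfst, hmem]
      rw [← h₁.sum_size, Finset.filter_univ_mem]
      refine (Finset.sum_subtype A (fun _ => Iff.rfl) _).trans (Finset.sum_congr rfl fun i _ => ?_)
      rw [glue_of_mem]

theorem firstChildData_fiber_eq_empty [Fintype I] [DecidableEq V] [DecidableEq I] {i₀ : I}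
    {A : Finset I} {S₁ : Finset V} {u : V} {l₁ : ℕ} (hl : ¬ l₁ + A.card ≤ l) :
    {e | e ∈ excursionFamilies I v S l ∧ firstChildData S i₀ e = ((A, ⟨S₁, u⟩), l₁)} = ∅ := by
  rw [Set.eq_empty_iff_forall_notMem]
  rintro e ⟨he, hd⟩
  simp only [firstChildData, Prod.mk.injEq] at hd
  apply hl
  rw [← hd.2, ← he.sum_size, hd.1.1, Finset.card_eq_sum_ones, ← Finset.sum_add_distrib]
  refine (Finset.sum_le_sum fun i _ => ?_).trans
    (Finset.sum_le_sum_of_subset (Finset.subset_univ A))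
  simp [excursion, size]

/-- Decomposition of a nonempty family of excursions according to the first child of the root. -/
theorem ncard_excursionFamilies_eq_sum [Fintype I] [DecidableEq V] [DecidableEq I] (hv : v ∉ S)
    (i₀ : I) :
    (excursionFamilies I v S l).ncard =
      ∑ A : Finset I with i₀ ∈ A, ∑ S₁ ∈ S.powerset, ∑ u ∈ S₁,
        if A.card ≤ l then ∑ p ∈ Finset.HasAntidiagonal.antidiagonal (l - A.card),
          (walkFamilies {i // i ∈ A} u (S₁.erase u) p.1).ncard *
            (excursionFamilies {i // ¬ i ∈ A} v (S \ S₁) p.2).ncard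
        else 0 := by
  classical
  rw [ncard_eq_sum_ncard_fiber finite_excursionFamilies (firstChildData S i₀)
    (((Finset.univ.filter fun A : Finset I => i₀ ∈ A) ×ˢ
      (S.powerset.sigma fun S₁ => S₁)) ×ˢ Finset.range (l + 1))]
  · rw [Finset.sum_product, Finset.sum_product]
    refine Finset.sum_congr rfl fun A hA => ?_
    rw [Finset.sum_sigma]
    refine Finset.sum_congr rfl fun S₁ hS₁ => Finset.sum_congr rfl fun u hu => ?_
    have hA := (Finset.mem_filter.1 hA).2
    have hS₁ := Finset.mem_powerset.1 hS₁
    split_ifs with hl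
    · rw [Finset.Nat.sum_antidiagonal_eq_sum_range_succ_mk]
      -- The larger values of `l₁` have empty fibres, because each excursion in `A` costs one unit
      -- beyond the walk below `u`.
      have hsub : Finset.range (l - A.card).succ ⊆ Finset.range (l + 1) :=
        Finset.range_subset_range.2 (by omega)
      rw [← Finset.sum_subset hsub]
      · refine Finset.sum_congr rfl fun l₁ hl₁ => ?_
        rw [Finset.mem_range] at hl₁
        rw [firstChildData_fiber hv hA hS₁ hu (by omega),
          Set.ncard_image_of_injective _ (glue_injective A u), Set.ncard_prod]
      · intro l₁ _ hl₁
        rw [Finset.mem_range] at hl₁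
        rw [firstChildData_fiber_eq_empty (by omega), Set.ncard_empty]
    · refine Finset.sum_eq_zero fun l₁ _ => ?_
      rw [firstChildData_fiber_eq_empty (by omega), Set.ncard_empty]
  · intro e he
    have he : Spans v S l _ := he
    simp only [firstChildData, Finset.mem_product, Finset.mem_filter, Finset.mem_univ, true_and,
      Finset.mem_sigma, Finset.mem_powerset, Finset.filter_subset, Finset.mem_range]
    refine ⟨⟨(he.mem_iff _).2 ⟨i₀, mem_labels_excursion.2 (Or.inl rfl)⟩, Or.inl trivial⟩, ?_⟩
    rw [Nat.lt_succ_iff, ← he.sum_size, sum_size_excursion]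
    exact (Finset.sum_le_sum_of_subset (Finset.filter_subset _ _)).trans (Nat.le_add_right _ _)

end

/-! ### Closed walks as lists of excursions -/

namespace PlaneTree

variable {V : Type}

/-- The list of the excursions from the root. -/
def toList : PlaneTree V → List (V × PlaneTree V)
  | nil => []
  | cons u d r => (u, d) :: r.toList

/-- The closed walk that makes the excursions of a list in turn. -/
def ofList : List (V × PlaneTree V) → PlaneTree V
  | [] => nil
  | p :: L => cons p.1 p.2 (ofList L)

theorem ofList_toList (t : PlaneTree V) : ofList t.toList = t := by
  induction t with
  | nil => rfl
  | cons u d r _ ih => simp [toList, ofList, ih]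

theorem toList_ofList (L : List (V × PlaneTree V)) : (ofList L).toList = L := by
  induction L with
  | nil => rfl
  | cons p L ih => simp [toList, ofList, ih]

theorem ofList_injective : Function.Injective (ofList : List (V × PlaneTree V) → PlaneTree V) :=
  Function.LeftInverse.injective toList_ofList

theorem mem_labels_ofList {x : V} {L : List (V × PlaneTree V)} :
    x ∈ (ofList L).labels ↔ ∃ p ∈ L, x ∈ (excursion p).labels := by
  induction L with
  | nil => simp [ofList, labels]
  | cons p L ih =>
    rw [List.exists_mem_cons_iff, ← ih, mem_labels_excursion]
    simp [ofList, labels, or_assoc]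

theorem size_ofList (L : List (V × PlaneTree V)) :
    (ofList L).size = (L.map fun p => (excursion p).size).sum := by
  induction L with
  | nil => rfl
  | cons p L ih => simp [ofList, size, excursion, ih]

theorem respects_ofList {π : V → V} {h : V → ℤ} {v : V} {L : List (V × PlaneTree V)} :
    Respects π h v (ofList L) ↔ ∀ p ∈ L, Respects π h v (excursion p) := by
  induction L with
  | nil => simp [ofList, Respects]
  | cons p L ih =>
    rw [List.forall_mem_cons, ← ih, respects_excursion]
    simp [ofList, Respects, and_assoc]

theorem length_toList_le_size (t : PlaneTree V) : t.toList.length ≤ t.size := by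
  induction t with
  | nil => simp [toList]
  | cons u d r _ ih =>
    simp only [toList, List.length_cons, size]
    omega

end PlaneTree

section

variable {V K I : Type} {v : V} {S : Finset V} {l : ℕ}

/-- Assemble a family of excursions into closed walks, the `k`-th of which makes `r k`
excursions. -/
def assemble (r : K → ℕ) (e : (Σ k, Fin (r k)) → V × PlaneTree V) : K → PlaneTree V :=
  fun k => ofList (List.ofFn fun j => e ⟨k, j⟩)

theorem assemble_injective (r : K → ℕ) :
    Function.Injective (assemble r : ((Σ k, Fin (r k)) → V × PlaneTree V) → K → PlaneTree V) := by
  intro e e' h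
  funext ⟨k, j⟩
  exact congrFun (List.ofFn_injective (ofList_injective (congrFun h k))) j

/-- Compatibility, visited vertices and total length do not depend on how the excursions are grouped
into walks. -/
theorem spans_assemble_iff [Fintype K] {r : K → ℕ} {e : (Σ k, Fin (r k)) → V × PlaneTree V} :
    Spans v S l (assemble r e) ↔ Spans v S l fun i => excursion (e i) := by
  have h1 : ∀ π h, (∀ k, Respects π h v (assemble r e k)) ↔
      ∀ i, Respects π h v (excursion (e i)) := fun π h => by
    simp [assemble, respects_ofList, Sigma.forall]
  have h2 : ∀ x, (∃ k, x ∈ (assemble r e k).labels) ↔ ∃ i, x ∈ (excursion (e i)).labels := by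
    intro x
    simp [assemble, mem_labels_ofList, List.mem_ofFn', Sigma.exists]
  have h3 : ∑ k, (assemble r e k).size = ∑ i, (excursion (e i)).size := by
    simp [assemble, size_ofList, List.sum_ofFn, Fintype.sum_sigma]
  constructor
  · rintro ⟨⟨π, h, hr⟩, hm, hs⟩
    exact ⟨⟨π, h, (h1 π h).1 hr⟩, fun x => (hm x).trans (h2 x), h3.symm.trans hs⟩
  · rintro ⟨⟨π, h, hr⟩, hm, hs⟩
    exact ⟨⟨π, h, (h1 π h).2 hr⟩, fun x => (hm x).trans (h2 x).symm, h3.trans hs⟩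

/-- Decomposition of a family of closed walks according to their numbers of excursions. -/
theorem ncard_walkFamilies_eq_sum [Fintype K] [DecidableEq K] :
    (walkFamilies K v S l).ncard =
      ∑ R ∈ Finset.range (l + 1), ∑ r ∈ (Finset.univ : Finset K).finsuppAntidiag R,
        (excursionFamilies (Σ k, Fin (r k)) v S l).ncard := by
  rw [ncard_eq_sum_ncard_fiber finite_walkFamilies
    (fun t : K → PlaneTree V => (⟨∑ k, (t k).toList.length,
      Finsupp.equivFunOnFinite.symm fun k => (t k).toList.length⟩ : Σ _ : ℕ, K →₀ ℕ))
    ((Finset.range (l + 1)).sigma fun R => (Finset.univ : Finset K).finsuppAntidiag R)]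
  · rw [Finset.sum_sigma]
    refine Finset.sum_congr rfl fun R _ => Finset.sum_congr rfl fun r hr => ?_
    rw [← Set.ncard_image_of_injective _ (assemble_injective (V := V) (r : K → ℕ))]
    congr 1
    ext t
    constructor
    · rintro ⟨ht, htr⟩
      have hr' : ∀ k, (t k).toList.length = r k := fun k => by
        rw [← eq_of_heq (Sigma.mk.inj_iff.1 htr).2]
        rfl
      have hta : assemble (r : K → ℕ) (fun i => (t i.1).toList.get (i.2.cast (hr' i.1).symm)) =
          t := by
        funext k
        rw [← ofList_toList (t k)]
        simp only [assemble]
        congr 1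
        refine List.ext_get (by simp [hr']) fun n _ _ => ?_
        simp
      refine ⟨_, ?_, hta⟩
      have ht : Spans v S l t := ht
      rw [← hta, spans_assemble_iff] at ht
      exact ht
    · rintro ⟨e, he, rfl⟩
      have hl : ∀ k, (assemble (r : K → ℕ) e k).toList.length = r k := fun k => by
        simp [assemble, toList_ofList]
      refine ⟨spans_assemble_iff.2 he, ?_⟩
      have hsum := (Finset.mem_finsuppAntidiag.1 hr).1
      simp only [hl]
      refine Sigma.ext hsum (heq_of_eq ?_)
      ext k
      rfl
  · intro t ht
    have ht : Spans v S l t := ht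
    rw [Finset.mem_sigma, Finset.mem_range, Finset.mem_finsuppAntidiag]
    refine ⟨?_, rfl, Finset.subset_univ _⟩
    rw [Nat.lt_succ_iff, ← ht.sum_size]
    exact Finset.sum_le_sum fun k _ => length_toList_le_size _

theorem excursionFamilies_of_isEmpty [Fintype I] [IsEmpty I] :
    (excursionFamilies I v S l).ncard = if S.card = 0 ∧ l = 0 then 1 else 0 := by
  have h : ∀ e : I → V × PlaneTree V, e ∈ excursionFamilies I v S l ↔ S.card = 0 ∧ l = 0 := by
    intro e
    constructor
    · intro he
      refine ⟨Finset.card_eq_zero.2 (Finset.eq_empty_of_forall_notMem fun x hx => ?_), ?_⟩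
      · obtain ⟨i, -⟩ := (he.mem_iff x).1 hx
        exact isEmptyElim i
      · rw [← he.sum_size]
        simp
    · rintro ⟨hS, rfl⟩
      rw [Finset.card_eq_zero] at hS
      subst hS
      exact ⟨⟨id, 0, fun i => isEmptyElim i⟩, by simp, by simp⟩
  split_ifs with hc
  · rw [Set.ncard_eq_one]
    exact ⟨isEmptyElim, Set.eq_singleton_iff_unique_mem.2
      ⟨(h _).2 hc, fun e _ => Subsingleton.elim _ _⟩⟩
  · rw [Set.ncard_eq_zero (finite_excursionFamilies), Set.eq_empty_iff_forall_notMem]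
    exact fun e he => hc ((h e).1 he)

end

/-! ### The numbers of families -/

/-- The number of `k`-tuples of closed walks of total length `2 * l` from a given root that span
a tree with `m` other vertices. -/
def numWalkFamilies (k m l : ℕ) : ℕ :=
  (walkFamilies (Fin k) (0 : ℕ) (Finset.Icc 1 m) l).ncard

/-- The number of `r`-tuples of excursions of total length `2 * l` from a given root that span
a tree with `m` other vertices. -/
def numExcursionFamilies (r m l : ℕ) : ℕ :=
  (excursionFamilies (Fin r) (0 : ℕ) (Finset.Icc 1 m) l).ncard

theorem sum_finset_mem_card {I : Type} [Fintype I] [DecidableEq I] (i₀ : I) {r : ℕ}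
    (hr : Fintype.card I = r + 1) (f : ℕ → ℕ) :
    ∑ A : Finset I with i₀ ∈ A, f A.card =
      ∑ s ∈ Finset.range (r + 1), r.choose s * f (s + 1) := by
  have h1 : (Finset.univ.filter fun A : Finset I => i₀ ∈ A) =
      ((Finset.univ.erase i₀).powerset).image (insert i₀) := by
    ext A
    simp only [Finset.mem_filter, Finset.mem_univ, true_and, Finset.mem_image,
      Finset.mem_powerset]
    constructor
    · exact fun h => ⟨A.erase i₀, Finset.erase_subset_erase _ (Finset.subset_univ _),
        Finset.insert_erase h⟩
    · rintro ⟨B, -, rfl⟩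
      exact Finset.mem_insert_self _ _
  have h2 : ∀ B ∈ (Finset.univ.erase i₀).powerset, i₀ ∉ B := fun B hB h =>
    (Finset.mem_erase.1 (Finset.mem_powerset.1 hB h)).1 rfl
  have h3 : (Finset.univ.erase i₀).card = r := by
    rw [Finset.card_erase_of_mem (Finset.mem_univ _), Finset.card_univ, hr, Nat.add_sub_cancel]
  rw [h1, Finset.sum_image]
  · rw [Finset.sum_congr rfl fun B hB => by rw [Finset.card_insert_of_notMem (h2 B hB)],
      Finset.sum_powerset_apply_card fun s => f (s + 1), h3]
    simp
  · intro B hB C hC h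
    rw [← Finset.erase_insert (h2 B hB), h, Finset.erase_insert (h2 C hC)]

/-- There are `multichoose` many ways to distribute `R` ordered excursions over the walks.
Invariance of the excursion counts is a hypothesis so that this can be used inside the induction of
`ncard_families`. -/
theorem ncard_walkFamilies_of_excursionFamilies {l : ℕ}
    (hB : ∀ {V I : Type} [Fintype I] (v : V) (S : Finset V), v ∉ S →
      (excursionFamilies I v S l).ncard = numExcursionFamilies (Fintype.card I) S.card l)
    {V K : Type} [Fintype K] (v : V) (S : Finset V) (hv : v ∉ S) :
    (walkFamilies K v S l).ncard = ∑ R ∈ Finset.range (l + 1),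
      (Fintype.card K).multichoose R * numExcursionFamilies R S.card l := by
  classical
  rw [ncard_walkFamilies_eq_sum]
  refine Finset.sum_congr rfl fun R _ => ?_
  rw [Finset.sum_congr rfl (g := fun _ => numExcursionFamilies R S.card l), Finset.sum_const,
    Finset.card_finsuppAntidiag_nat_eq_multichoose, Finset.card_univ, smul_eq_mul]
  intro r hr
  rw [hB v S hv, Fintype.card_sigma]
  simp only [Fintype.card_fin]
  rw [(Finset.mem_finsuppAntidiag.1 hr).1]

/-- Removing the steps to the first child leaves strictly shorter families, so invariance is needed
only below `l`. The factor `m` is the choice of the child among the `m` vertices of its subtree. -/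
theorem ncard_excursionFamilies_of_lt {l : ℕ}
    (hA : ∀ l' < l, ∀ {V K : Type} [Fintype K] (v : V) (S : Finset V), v ∉ S →
      (walkFamilies K v S l').ncard = numWalkFamilies (Fintype.card K) S.card l')
    (hB : ∀ l' < l, ∀ {V I : Type} [Fintype I] (v : V) (S : Finset V), v ∉ S →
      (excursionFamilies I v S l').ncard = numExcursionFamilies (Fintype.card I) S.card l')
    {V I : Type} [Fintype I] (v : V) (S : Finset V) (hv : v ∉ S) {r : ℕ}
    (hr : Fintype.card I = r + 1) :
    (excursionFamilies I v S l).ncard =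
      ∑ s ∈ Finset.range (r + 1), r.choose s * ∑ m ∈ Finset.range (S.card + 1),
        S.card.choose m * (m * if s + 1 ≤ l then
          ∑ p ∈ Finset.HasAntidiagonal.antidiagonal (l - (s + 1)),
            numWalkFamilies (s + 1) (m - 1) p.1 * numExcursionFamilies (r - s) (S.card - m) p.2
        else 0) := by
  classical
  obtain ⟨i₀⟩ : Nonempty I := Fintype.card_pos_iff.1 (by omega)
  rw [ncard_excursionFamilies_eq_sum hv i₀]
  have key : ∀ A : Finset I, i₀ ∈ A → (∑ S₁ ∈ S.powerset, ∑ u ∈ S₁,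
        if A.card ≤ l then ∑ p ∈ Finset.HasAntidiagonal.antidiagonal (l - A.card),
          (walkFamilies {i // i ∈ A} u (S₁.erase u) p.1).ncard *
            (excursionFamilies {i // ¬ i ∈ A} v (S \ S₁) p.2).ncard
        else 0) = ∑ m ∈ Finset.range (S.card + 1),
        S.card.choose m * (m * if A.card ≤ l then
          ∑ p ∈ Finset.HasAntidiagonal.antidiagonal (l - A.card),
            numWalkFamilies A.card (m - 1) p.1 *
              numExcursionFamilies (r + 1 - A.card) (S.card - m) p.2
        else 0) := by
    intro A hiA
    have hApos : 0 < A.card := Finset.card_pos.2 ⟨i₀, hiA⟩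
    have := Finset.sum_powerset_apply_card (x := S) fun m => (m * if A.card ≤ l then
          ∑ p ∈ Finset.HasAntidiagonal.antidiagonal (l - A.card),
            numWalkFamilies A.card (m - 1) p.1 *
              numExcursionFamilies (r + 1 - A.card) (S.card - m) p.2
        else 0)
    simp only [smul_eq_mul] at this
    rw [← this]
    refine Finset.sum_congr rfl fun S₁ hS₁ => ?_
    rw [Finset.mem_powerset] at hS₁
    rw [← smul_eq_mul, ← Finset.sum_const]
    refine Finset.sum_congr rfl fun u hu => ?_
    split_ifs with hl
    · refine Finset.sum_congr rfl fun p hp => ?_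
      rw [Finset.HasAntidiagonal.mem_antidiagonal] at hp
      rw [hA p.1 (by omega) u _ (Finset.notMem_erase u S₁), hB p.2 (by omega) v _
        (fun h => hv (Finset.mem_sdiff.1 h).1), Finset.card_erase_of_mem hu,
        Finset.card_sdiff_of_subset hS₁, Fintype.card_subtype_compl]
      simp [hr]
    · rfl
  rw [Finset.sum_congr rfl fun A hA => key A (Finset.mem_filter.1 hA).2,
    sum_finset_mem_card i₀ hr fun n => ∑ m ∈ Finset.range (S.card + 1),
        S.card.choose m * (m * if n ≤ l then
          ∑ p ∈ Finset.HasAntidiagonal.antidiagonal (l - n),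
            numWalkFamilies n (m - 1) p.1 *
              numExcursionFamilies (r + 1 - n) (S.card - m) p.2
        else 0)]
  simp only [Nat.add_sub_add_right]

/-- The number of spanning families depends only on the sizes of the index set and of the
set of vertices. -/
theorem ncard_families (l : ℕ) :
    (∀ {V I : Type} [Fintype I] (v : V) (S : Finset V), v ∉ S →
      (excursionFamilies I v S l).ncard = numExcursionFamilies (Fintype.card I) S.card l) ∧
    (∀ {V K : Type} [Fintype K] (v : V) (S : Finset V), v ∉ S →
      (walkFamilies K v S l).ncard = numWalkFamilies (Fintype.card K) S.card l) := by
  induction l using Nat.strong_induction_on with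
  | _ l ih =>
    have h0 : ∀ m : ℕ, (0 : ℕ) ∉ Finset.Icc 1 m := by simp
    -- Excursions come first: they reduce to smaller lengths, whereas walks of length `l` reduce to
    -- excursions of the same length.
    have hB : ∀ {V I : Type} [Fintype I] (v : V) (S : Finset V), v ∉ S →
        (excursionFamilies I v S l).ncard = numExcursionFamilies (Fintype.card I) S.card l := by
      intro V I _ v S hv
      rcases Nat.eq_zero_or_pos (Fintype.card I) with h | h
      · have := Fintype.card_eq_zero_iff.1 h
        rw [excursionFamilies_of_isEmpty, h, numExcursionFamilies, excursionFamilies_of_isEmpty]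
        rw [Nat.card_Icc, Nat.add_sub_cancel]
      · obtain ⟨r, hr⟩ : ∃ r, Fintype.card I = r + 1 := ⟨Fintype.card I - 1, by omega⟩
        rw [ncard_excursionFamilies_of_lt (fun l' hl' => (ih l' hl').2)
            (fun l' hl' => (ih l' hl').1) v S hv hr, numExcursionFamilies,
          ncard_excursionFamilies_of_lt (fun l' hl' => (ih l' hl').2)
            (fun l' hl' => (ih l' hl').1) 0 _ (h0 _) (by simpa using hr)]
        simp
    refine ⟨hB, fun {V K} _ v S hv => ?_⟩
    rw [ncard_walkFamilies_of_excursionFamilies hB v S hv, numWalkFamilies,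
      ncard_walkFamilies_of_excursionFamilies hB 0 _ (h0 _)]
    simp

theorem numExcursionFamilies_zero (m l : ℕ) :
    numExcursionFamilies 0 m l = if m = 0 ∧ l = 0 then 1 else 0 := by
  rw [numExcursionFamilies, excursionFamilies_of_isEmpty]
  simp

theorem numWalkFamilies_eq_sum (k m l : ℕ) :
    numWalkFamilies k m l =
      ∑ R ∈ Finset.range (l + 1), k.multichoose R * numExcursionFamilies R m l := by
  rw [numWalkFamilies, ncard_walkFamilies_of_excursionFamilies (ncard_families l).1 0 _ (by simp)]
  simp

theorem numExcursionFamilies_succ (r m l : ℕ) :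
    numExcursionFamilies (r + 1) m l =
      ∑ s ∈ Finset.range (r + 1), r.choose s * ∑ m₁ ∈ Finset.range (m + 1),
        m.choose m₁ * (m₁ * if s + 1 ≤ l then
          ∑ p ∈ Finset.HasAntidiagonal.antidiagonal (l - (s + 1)),
            numWalkFamilies (s + 1) (m₁ - 1) p.1 * numExcursionFamilies (r - s) (m - m₁) p.2
        else 0) := by
  rw [numExcursionFamilies, ncard_excursionFamilies_of_lt (fun l' _ => (ncard_families l').2)
    (fun l' _ => (ncard_families l').1) 0 _ (by simp) (r := r) (by simp)]
  simp


/-! ### Closed walks as words -/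

namespace PlaneTree

variable {V : Type}

/-- The sequence of the vertices visited by a closed walk at `v`. -/
def word : V → PlaneTree V → List V
  | v, nil => [v]
  | v, cons u d r => v :: (word u d ++ word v r)

theorem word_eq_cons (v : V) (t : PlaneTree V) : ∃ L, word v t = v :: L := by
  cases t with
  | nil => exact ⟨[], rfl⟩
  | cons u d r => exact ⟨_, rfl⟩

theorem head?_word (v : V) (t : PlaneTree V) : (word v t).head? = some v := by
  obtain ⟨L, hL⟩ := word_eq_cons v t
  simp [hL]

theorem getLast?_word (v : V) (t : PlaneTree V) : (word v t).getLast? = some v := by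
  induction t generalizing v with
  | nil => rfl
  | cons u d r _ ihr =>
    obtain ⟨L, hL⟩ := word_eq_cons v r
    rw [word, List.getLast?_cons, List.getLast?_append, ihr]
    rfl

theorem length_word (v : V) (t : PlaneTree V) : (word v t).length = 2 * t.size + 1 := by
  induction t generalizing v with
  | nil => rfl
  | cons u d r ihd ihr =>
    simp only [word, List.length_cons, List.length_append, ihd, ihr, size]
    ring

theorem mem_word {v x : V} {t : PlaneTree V} : x ∈ word v t ↔ x = v ∨ x ∈ t.labels := by
  induction t generalizing v with
  | nil => simp [word, labels]
  | cons u d r ihd ihr =>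
    simp only [word, List.mem_cons, List.mem_append, ihd, ihr, labels, Set.mem_insert_iff,
      Set.mem_union]
    tauto

/-- One of `a`, `b` is the parent of the other. -/
def ParentOrChild (π : V → V) (h : V → ℤ) (a b : V) : Prop :=
  (π b = a ∧ h b = h a + 1) ∨ (π a = b ∧ h a = h b + 1)

theorem Respects.isChain_word {π : V → V} {h : V → ℤ} {v : V} {t : PlaneTree V}
    (ht : Respects π h v t) : (word v t).IsChain (ParentOrChild π h) := by
  induction t generalizing v with
  | nil => exact List.isChain_singleton v
  | cons u d r ihd ihr =>
    obtain ⟨h1, h3, h4⟩ := ht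
    rw [word, List.isChain_cons, List.isChain_append]
    refine ⟨?_, ihd h3, ihr h4, ?_⟩
    · obtain ⟨L, hL⟩ := word_eq_cons u d
      simp [hL, ParentOrChild, h1]
    · rw [getLast?_word, head?_word]
      simp [ParentOrChild, h1]

theorem append_cons_inj_of_notMem {a : V} {x₁ x₂ z₁ z₂ : List V} (h₁ : a ∉ x₁) (h₂ : a ∉ x₂)
    (h : x₁ ++ a :: z₁ = x₂ ++ a :: z₂) : x₁ = x₂ ∧ z₁ = z₂ := by
  induction x₁ generalizing x₂ with
  | nil =>
    cases x₂ with
    | nil => simpa using h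
    | cons b x₂ =>
      rw [List.nil_append, List.cons_append, List.cons.injEq] at h
      exact absurd (h.1 ▸ List.mem_cons_self) h₂
  | cons b x₁ ih =>
    cases x₂ with
    | nil =>
      rw [List.nil_append, List.cons_append, List.cons.injEq] at h
      exact absurd (h.1 ▸ List.mem_cons_self) h₁
    | cons c x₂ =>
      rw [List.cons_append, List.cons_append, List.cons.injEq] at h
      obtain ⟨rfl, h⟩ := h
      rw [List.mem_cons, not_or] at h₁ h₂
      obtain ⟨rfl, hz⟩ := ih h₁.2 h₂.2 h
      exact ⟨rfl, hz⟩

/-- The first return to `v` marks the end of the first excursion, because `v` does not occur in the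
word of the subtree. -/
theorem Respects.word_injective {π π' : V → V} {h h' : V → ℤ} {v : V} {t t' : PlaneTree V}
    (ht : Respects π h v t) (ht' : Respects π' h' v t') (hw : word v t = word v t') : t = t' := by
  induction t generalizing v t' with
  | nil =>
    cases t' with
    | nil => rfl
    | cons u' d' r' =>
      have := congrArg List.length hw
      simp only [length_word, size] at this
      omega
  | cons u d r ihd ihr =>
    cases t' with
    | nil =>
      have := congrArg List.length hw
      simp only [length_word, size] at this
      omega
    | cons u' d' r' =>
      have key : ∀ {π : V → V} {h : V → ℤ} {u : V} {d r : PlaneTree V},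
          Respects π h v (cons u d r) → v ∉ word u d := by
        rintro π h u d r ⟨⟨-, h2⟩, h3, -⟩ hv
        rcases mem_word.1 hv with rfl | hv
        · omega
        · obtain ⟨n, h5, -⟩ := h3.exists_iterate hv
          omega
      obtain ⟨L, hL⟩ := word_eq_cons v r
      obtain ⟨L', hL'⟩ := word_eq_cons v r'
      have hw' : word u d ++ v :: L = word u' d' ++ v :: L' := by
        rw [← hL, ← hL']
        simpa [word] using hw
      obtain ⟨h1, h2⟩ := append_cons_inj_of_notMem (key ht) (key ht') hw'
      obtain rfl : u = u' := by
        have := congrArg List.head? h1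
        simpa [head?_word] using this
      rw [ihd ht.2.1 ht'.2.1 h1, ihr ht.2.2 ht'.2.2 (by rw [hL, hL', h2])]

/-- A walk on a rooted tree starts with a closed walk in the subtree below its starting point. -/
theorem exists_word_append {π : V → V} {h : V → ℤ} (v : V) (L : List V)
    (hc : (v :: L).IsChain (ParentOrChild π h))
    (hl : h ((v :: L).getLast (List.cons_ne_nil v L)) ≤ h v) :
    ∃ t L', v :: L = word v t ++ L' ∧ Respects π h v t ∧
      (L' = [] ∨ ∃ b L'', L' = b :: L'' ∧ π v = b ∧ h v = h b + 1) := by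
  induction hn : L.length using Nat.strong_induction_on generalizing v L with
  | _ n ih =>
    cases L with
    | nil => exact ⟨nil, [], rfl, trivial, Or.inl rfl⟩
    | cons b L =>
      rw [List.isChain_cons_cons] at hc
      -- A step to a child opens an excursion; a step to the parent ends the closed walk at `v`.
      obtain ⟨h1 | h1, hc⟩ := hc
      · rw [List.getLast_cons (List.cons_ne_nil b L)] at hl
        obtain ⟨d, L₂, h2, h3, h4⟩ := ih L.length (by simp [← hn]) b L hc (by omega) rfl
        rcases h4 with rfl | ⟨c, L₃, rfl, h5, h6⟩
        · have h7 : h ((b :: L).getLast (List.cons_ne_nil b L)) = h b := by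
            have := getLast?_word b d
            rw [← (List.append_nil (word b d)), ← h2,
              List.getLast?_eq_getLast_of_ne_nil (List.cons_ne_nil b L)] at this
            rw [Option.some.inj this]
          omega
        -- The subtree of `b` can be left only towards the parent of `b`, which is `v`.
        · obtain rfl : v = c := h1.1.symm.trans h5
          have hlen := congrArg List.length h2
          simp only [List.length_cons, List.length_append, length_word] at hlen hn
          have hc₃ : (v :: L₃).IsChain (ParentOrChild π h) := by
            rw [h2] at hc
            exact hc.right_of_append
          have hl₃ : h ((v :: L₃).getLast (List.cons_ne_nil v L₃)) ≤ h v := by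
            have : (b :: L).getLast (List.cons_ne_nil b L) =
                (v :: L₃).getLast (List.cons_ne_nil v L₃) := by
              simp only [h2]
              rw [List.getLast_append_of_ne_nil]
            rwa [← this]
          obtain ⟨r, L', h8, h9, h10⟩ := ih L₃.length (by omega) v L₃ hc₃ hl₃ rfl
          refine ⟨cons b d r, L', ?_, ⟨h1, h3, h9⟩, h10⟩
          rw [h2, h8]
          simp [word]
      · exact ⟨nil, b :: L, rfl, trivial, Or.inr ⟨b, L, rfl, h1⟩⟩

end PlaneTree

/-! ### Closed words in the complete graph and tree walks -/

/-- The vertex sequences of the closed walks of length `k` on the complete graph on `V`. -/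
def closedWords (V : Type) (k : ℕ) : Set (List V) :=
  {l | l.length = k + 1 ∧ l.IsChain (· ≠ ·) ∧ l.head? = l.getLast?}

/-- The set of edges traversed by a word. -/
def wordEdges {V : Type} (l : List V) : Set (Sym2 V) :=
  {e | e ∈ List.zipWith (s(·, ·)) l l.tail}

section

variable {V : Type}

theorem wordEdges_support {G : SimpleGraph V} {u v : V} (p : G.Walk u v) :
    wordEdges p.support = {e | e ∈ p.edges} := by
  rw [wordEdges, ← SimpleGraph.Walk.edges_eq_zipWith_support]

theorem support_mem_closedWords (W : Σ u : V, (⊤ : SimpleGraph V).Walk u u) :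
    W.2.support ∈ closedWords V W.2.length := by
  obtain ⟨u, p⟩ := W
  refine ⟨p.length_support, p.isChain_adj_support.imp fun a b h => h, ?_⟩
  rw [List.head?_eq_some_head p.support_ne_nil, List.getLast?_eq_some_getLast p.support_ne_nil]
  simp

theorem support_injective :
    Function.Injective fun W : Σ u : V, (⊤ : SimpleGraph V).Walk u u => W.2.support := by
  rintro ⟨u, p⟩ ⟨v, q⟩ h
  have h : p.support = q.support := h
  obtain rfl : u = v := by
    rw [← p.head_support, ← q.head_support]
    simp only [h]
  rw [SimpleGraph.Walk.ext_support h]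

theorem exists_walk_of_mem_closedWords {k : ℕ} {l : List V} (hl : l ∈ closedWords V k) :
    ∃ W : Σ u : V, (⊤ : SimpleGraph V).Walk u u, W.2.length = k ∧ W.2.support = l := by
  obtain ⟨h1, h2, h3⟩ := hl
  have hne : l ≠ [] := by
    rintro rfl
    simp at h1
  have hc : l.IsChain (⊤ : SimpleGraph V).Adj := h2.imp fun a b h => h
  rw [List.head?_eq_some_head hne, List.getLast?_eq_some_getLast hne] at h3
  refine ⟨⟨l.head hne, (SimpleGraph.Walk.ofSupport l hne hc).copy rfl (Option.some.inj h3).symm⟩,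
    ?_, ?_⟩
  · simp [h1]
  · simp

theorem finite_closedWords [Finite V] (k : ℕ) : (closedWords V k).Finite :=
  (List.finite_length_eq V (k + 1)).subset fun _ hl => hl.1

/-- The parent of `x` is the penultimate vertex of the path from `r` to `x`, and the height is the
length of that path. For adjacent vertices, one of the two paths extends the other by the edge. -/
theorem exists_parentOrChild_of_isTree {G : SimpleGraph V} (hG : G.IsTree) (r : V) :
    ∃ (π : V → V) (h : V → ℤ), (∀ x, h r ≤ h x) ∧ ∀ a b, G.Adj a b → ParentOrChild π h a b := by
  choose p hp _ using fun x => hG.existsUnique_path r x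
  have hp : ∀ x, (p x).IsPath := hp
  refine ⟨fun x => (p x).penultimate, fun x => (p x).length, fun x => ?_, ?_⟩
  · simp [SimpleGraph.Walk.length_eq_zero_iff.2 (SimpleGraph.Walk.isPath_iff_nil.1 (hp r))]
  · have key : ∀ a b, G.Adj a b → a ∈ (p b).support →
        (p b).penultimate = a ∧ ((p b).length : ℤ) = (p a).length + 1 := by
      intro a b hab ha
      refine ⟨(hG.isAcyclic.eq_penultimate_of_adj_end (hp b) hab.symm ha).symm, ?_⟩
      rw [hG.isAcyclic.path_concat (hp a) (hp b) hab ha]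
      simp
    intro a b hab
    by_cases ha : a ∈ (p b).support
    · exact Or.inl (key a b hab ha)
    · exact Or.inr (key b a hab.symm
        (hG.isAcyclic.mem_support_of_ne_mem_support_of_adj_of_isPath (hp a) (hp b) hab ha))

theorem isChain_support_mem_edges {G : SimpleGraph V} {u v : V} (p : G.Walk u v) :
    p.support.IsChain fun a b => s(a, b) ∈ p.edges := by
  induction p with
  | nil => simp
  | cons h p ih =>
    rw [SimpleGraph.Walk.support_cons, List.isChain_cons]
    refine ⟨?_, ih.imp fun a b h => by simp [h]⟩
    rw [List.head?_eq_some_head p.support_ne_nil]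
    simp

theorem exists_rel_of_mem_wordEdges {R : V → V → Prop} {l : List V} (hl : l.IsChain R)
    {e : Sym2 V} (he : e ∈ wordEdges l) : ∃ a b, a ∈ l ∧ b ∈ l ∧ R a b ∧ e = s(a, b) := by
  induction l with
  | nil => simp [wordEdges] at he
  | cons a l ih =>
    cases l with
    | nil => simp [wordEdges] at he
    | cons b l =>
      rw [List.isChain_cons_cons] at hl
      rw [wordEdges, Set.mem_ofPred, List.tail_cons, List.zipWith_cons_cons, List.mem_cons] at he
      rcases he with rfl | he
      · exact ⟨a, b, by simp, by simp, hl.1, rfl⟩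
      · obtain ⟨c, d, hc, hd, h1, h2⟩ := ih hl.2 he
        exact ⟨c, d, List.mem_cons_of_mem _ hc, List.mem_cons_of_mem _ hd, h1, h2⟩

/-- The vertex sequences of the closed walks of length `k` that visit every vertex of `V` and
traverse `e` edges. -/
def spanningWords (V : Type) (k e : ℕ) : Set (List V) :=
  {l | l ∈ closedWords V k ∧ (∀ x, x ∈ l) ∧ (wordEdges l).ncard = e}

theorem connected_spanningCoe_toSubgraph {u v : V} {G : SimpleGraph V} (p : G.Walk u v)
    (hp : ∀ x, x ∈ p.support) : p.toSubgraph.spanningCoe.Connected := by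
  have h := p.toSubgraph_connected.coe
  have hs : p.toSubgraph.IsSpanning := fun x => p.mem_verts_toSubgraph.2 (hp x)
  exact (p.toSubgraph.spanningCoeEquivCoeOfSpanning hs).connected_iff.2 h

/-- The traversed graph is automatically connected, so being a tree is a matter of counting edges.
-/
theorem isTree_iff_ncard_wordEdges [Finite V] {u : V} (p : (⊤ : SimpleGraph V).Walk u u)
    (hp : ∀ x, x ∈ p.support) :
    p.toSubgraph.spanningCoe.IsTree ↔ (wordEdges p.support).ncard + 1 = Nat.card V := by
  rw [SimpleGraph.isTree_iff_connected_and_card,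
    and_iff_right (connected_spanningCoe_toSubgraph p hp), SimpleGraph.Subgraph.edgeSet_spanningCoe,
    SimpleGraph.Walk.edgeSet_toSubgraph, Nat.card_coe_set_eq, wordEdges_support]
  rfl

theorem card_le_ncard_wordEdges [Finite V] {k e : ℕ} {l : List V} (hl : l ∈ spanningWords V k e) :
    Nat.card V ≤ e + 1 := by
  obtain ⟨W, -, rfl⟩ := exists_walk_of_mem_closedWords hl.1
  have h := (connected_spanningCoe_toSubgraph W.2 hl.2.1).card_vert_le_card_edgeSet_add_one
  rwa [SimpleGraph.Subgraph.edgeSet_spanningCoe, SimpleGraph.Walk.edgeSet_toSubgraph,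
    Nat.card_coe_set_eq, show W.2.edgeSet = wordEdges W.2.support from (wordEdges_support _).symm,
    hl.2.2] at h

end

theorem numTreeWalks_eq_ncard (m k : ℕ) :
    numTreeWalks (m + 1) k = (spanningWords (Fin (m + 1)) k m).ncard := by
  rw [numTreeWalks, ← Nat.card_coe_set_eq]
  refine Nat.card_congr (Equiv.ofBijective (fun W => ⟨W.1.2.support, ?_⟩) ⟨?_, ?_⟩)
  · obtain ⟨W, rfl, h2, h3⟩ := W
    refine ⟨support_mem_closedWords W, h2, ?_⟩
    rw [isTree_iff_ncard_wordEdges _ h2] at h3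
    simpa using h3
  · intro W W' h
    exact Subtype.ext (support_injective (congrArg Subtype.val h))
  · rintro ⟨l, h1, h2, h3⟩
    obtain ⟨W, hW, rfl⟩ := exists_walk_of_mem_closedWords h1
    refine ⟨⟨W, hW, h2, ?_⟩, rfl⟩
    rw [isTree_iff_ncard_wordEdges _ h2, h3]
    simp

theorem numTreeWalks_zero (k : ℕ) : numTreeWalks 0 k = 0 := by
  rw [numTreeWalks, Nat.card_eq_zero]
  exact Or.inl ⟨fun W => W.1.1.elim0⟩

/-- Bridge between walks and plane trees. A tree walk is parsed after rooting its tree at the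
starting vertex. Conversely, the edges of a plane tree word join non-root vertices to their parents,
so there are at most `m`, and connectedness gives at least `m`. -/
theorem mem_spanningWords_iff {V : Type} [Fintype V] [DecidableEq V] {k m : ℕ}
    (hV : Fintype.card V = m + 1) (l : List V) :
    l ∈ spanningWords V k m ↔ ∃ (v : V) (n : ℕ) (t : Unit → PlaneTree V),
      t ∈ walkFamilies Unit v (Finset.univ.erase v) n ∧ k = 2 * n ∧ l = word v (t ()) := by
  constructor
  · rintro ⟨h1, h2, h3⟩
    obtain ⟨⟨v, p⟩, rfl, rfl⟩ := exists_walk_of_mem_closedWords h1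
    have htree : p.toSubgraph.spanningCoe.IsTree := by
      rw [isTree_iff_ncard_wordEdges p h2, h3, Nat.card_eq_fintype_card, hV]
    obtain ⟨π, h, hmin, hadj⟩ := exists_parentOrChild_of_isTree htree v
    have hc : p.support.IsChain (ParentOrChild π h) :=
      (isChain_support_mem_edges p).imp fun a b hab => hadj a b
        (SimpleGraph.Walk.adj_toSubgraph_iff_mem_edges.2 hab)
    have hsupp : p.support = v :: p.support.tail := p.cons_tail_support.symm
    have hlast : h ((v :: p.support.tail).getLast (List.cons_ne_nil _ _)) ≤ h v := by
      simp only [← hsupp, p.getLast_support, le_refl]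
    rw [hsupp] at hc
    obtain ⟨t, L, h4, h5, h6⟩ := exists_word_append v _ hc hlast
    -- A remainder would have to start below the root, whose height is minimal.
    have hL : L = [] := by
      rcases h6 with h6 | ⟨b, -, -, -, h6⟩
      · exact h6
      · have := hmin b
        omega
    rw [← hsupp, hL, List.append_nil] at h4
    have hlen := congrArg List.length h4
    rw [p.length_support, length_word] at hlen
    refine ⟨v, t.size, fun _ => t, ⟨⟨π, h, fun _ => h5⟩, fun x => ?_, by simp⟩,
      Nat.succ_injective hlen, h4⟩
    have hx := h2 x
    simp only [h4, mem_word] at hx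
    constructor
    · intro hxv
      exact ⟨(), hx.resolve_left (Finset.ne_of_mem_erase hxv)⟩
    · rintro ⟨-, hxt⟩
      refine Finset.mem_erase.2 ⟨?_, Finset.mem_univ x⟩
      rintro rfl
      exact h5.root_notMem hxt
  · rintro ⟨v, n, t, ht, rfl, rfl⟩
    have ht : Spans v (Finset.univ.erase v) n t := ht
    obtain ⟨π, h, hr⟩ := ht.respects
    have hr := hr ()
    have hmem : ∀ x, x ∈ word v (t ()) := fun x => by
      rw [mem_word]
      by_cases hx : x = v
      · exact Or.inl hx
      · obtain ⟨⟨⟩, hk⟩ := (ht.mem_iff x).1 (Finset.mem_erase.2 ⟨hx, Finset.mem_univ x⟩)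
        exact Or.inr hk
    have hmin : ∀ x, h v ≤ h x := fun x => by
      rcases mem_word.1 (hmem x) with rfl | hx
      · exact le_rfl
      · obtain ⟨n, h1, -⟩ := hr.exists_iterate hx
        omega
    have hclosed : word v (t ()) ∈ closedWords V (2 * n) := by
      refine ⟨?_, hr.isChain_word.imp fun a b hab => ?_, by rw [head?_word, getLast?_word]⟩
      · rw [length_word, ← ht.sum_size]
        simp
      · rintro rfl
        rcases hab with hab | hab <;> omega
    have hle : (wordEdges (word v (t ()))).ncard ≤ m := by
      have hsub : wordEdges (word v (t ())) ⊆
          (fun x => s(x, π x)) '' ((Finset.univ.erase v : Finset V) : Set V) := by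
        intro e he
        obtain ⟨a, b, -, -, hab, rfl⟩ := exists_rel_of_mem_wordEdges hr.isChain_word he
        rcases hab with ⟨h1, h2⟩ | ⟨h1, h2⟩
        · refine ⟨b, ?_, by simp [h1, Sym2.eq_swap]⟩
          have := hmin a
          simp only [Finset.coe_erase, Finset.coe_univ, Set.mem_sdiff, Set.mem_univ, true_and,
            Set.mem_singleton_iff]
          rintro rfl
          omega
        · refine ⟨a, ?_, by simp [h1]⟩
          have := hmin b
          simp only [Finset.coe_erase, Finset.coe_univ, Set.mem_sdiff, Set.mem_univ, true_and,
            Set.mem_singleton_iff]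
          rintro rfl
          omega
      refine (Set.ncard_le_ncard hsub (Set.toFinite _)).trans
        ((Set.ncard_image_le (Set.toFinite _)).trans ?_)
      rw [Set.ncard_coe_finset, Finset.card_erase_of_mem (Finset.mem_univ v), Finset.card_univ, hV,
        Nat.add_sub_cancel]
    have hge := card_le_ncard_wordEdges (V := V) ⟨hclosed, hmem, rfl⟩
    rw [Nat.card_eq_fintype_card, hV] at hge
    exact ⟨hclosed, hmem, by omega⟩

theorem numTreeWalks_odd (m l : ℕ) : numTreeWalks m (2 * l + 1) = 0 := by
  cases m with
  | zero => exact numTreeWalks_zero _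
  | succ m =>
    rw [numTreeWalks_eq_ncard, Set.ncard_eq_zero ((finite_closedWords _).subset fun _ h => h.1),
      Set.eq_empty_iff_forall_notMem]
    intro w hw
    obtain ⟨v, n, t, -, h, -⟩ := (mem_spanningWords_iff (by simp) w).1 hw
    omega

theorem numTreeWalks_even (m l : ℕ) :
    numTreeWalks (m + 1) (2 * l) = (m + 1) * numWalkFamilies 1 m l := by
  rw [numTreeWalks_eq_ncard,
    ncard_eq_sum_ncard_fiber ((finite_closedWords _).subset fun _ h => h.1)
      -- Closed words are nonempty, so the default value is never taken; the fibres are indexed by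
      -- the starting vertex.
      (fun w : List (Fin (m + 1)) => w.head?.getD 0) Finset.univ (fun _ _ => Finset.mem_univ _),
    Finset.sum_congr rfl (g := fun _ => numWalkFamilies 1 m l)]
  · simp
  intro v _
  have h := (ncard_families l).2 (K := Unit) v (Finset.univ.erase v) (Finset.notMem_erase v _)
  rw [Finset.card_erase_of_mem (Finset.mem_univ v), Finset.card_univ, Fintype.card_fin,
    Nat.add_sub_cancel, Fintype.card_unit] at h
  rw [← h]
  symm
  refine Set.ncard_congr (fun t _ => word v (t ())) ?_ ?_ ?_
  · intro t ht
    refine ⟨(mem_spanningWords_iff (by simp) _).2 ⟨v, l, t, ht, rfl, rfl⟩, ?_⟩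
    simp [head?_word]
  · intro t t' ht ht' hw
    have ht : Spans v _ l t := ht
    have ht' : Spans v _ l t' := ht'
    obtain ⟨π, h, hr⟩ := ht.respects
    obtain ⟨π', h', hr'⟩ := ht'.respects
    funext x
    exact (hr x).word_injective (hr' x) hw
  · rintro w ⟨hw, hv⟩
    obtain ⟨v', n, t, ht, hn, rfl⟩ := (mem_spanningWords_iff (by simp) w).1 hw
    obtain rfl : l = n := by omega
    obtain rfl : v' = v := by simpa [head?_word] using hv
    exact ⟨t, ht, rfl⟩


/-! ### Generating functions -/

/-- The number of unlabelled spanning `k`-tuples of closed walks. -/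
def walkCount (k m l : ℕ) : ℚ := numWalkFamilies k m l / m !

/-- The number of unlabelled spanning `r`-tuples of excursions. -/
def excursionCount (r m l : ℕ) : ℚ := numExcursionFamilies r m l / m !

theorem walkCount_eq_sum (k m l : ℕ) :
    walkCount k m l =
      ∑ R ∈ Finset.range (l + 1), (k.multichoose R : ℚ) * excursionCount R m l := by
  rw [walkCount, numWalkFamilies_eq_sum, Nat.cast_sum, Finset.sum_div]
  refine Finset.sum_congr rfl fun R _ => ?_
  rw [excursionCount, Nat.cast_mul, mul_div_assoc]

theorem excursionCount_succ_zero (r l : ℕ) : excursionCount (r + 1) 0 l = 0 := by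
  simp [excursionCount, numExcursionFamilies_succ]

/-- Division by factorials turns the sum over vertex subsets into a plain convolution; the choice of
the child cancels one factor, whence `m` in place of `m + 1`. -/
theorem excursionCount_succ_succ (r m l : ℕ) :
    excursionCount (r + 1) (m + 1) l = ∑ s ∈ Finset.range (r + 1), (r.choose s : ℚ) *
      if s + 1 ≤ l then ∑ p ∈ Finset.HasAntidiagonal.antidiagonal (l - (s + 1)),
        ∑ q ∈ Finset.HasAntidiagonal.antidiagonal m,
          walkCount (s + 1) q.1 p.1 * excursionCount (r - s) q.2 p.2
      else 0 := by
  rw [excursionCount, numExcursionFamilies_succ, Nat.cast_sum, Finset.sum_div]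
  refine Finset.sum_congr rfl fun s _ => ?_
  rw [Nat.cast_mul, mul_div_assoc, Finset.sum_range_succ']
  congr 1
  split_ifs with hs
  · conv_rhs => rw [Finset.sum_comm, Finset.Nat.sum_antidiagonal_eq_sum_range_succ_mk]
    rw [zero_mul, mul_zero, add_zero, Nat.cast_sum, Finset.sum_div]
    refine Finset.sum_congr rfl fun j hj => ?_
    rw [Finset.mem_range] at hj
    rw [← mul_assoc, Finset.mul_sum, Nat.cast_sum, Finset.sum_div]
    refine Finset.sum_congr rfl fun p _ => ?_
    have h1 : m + 1 - (j + 1) = m - j := by omega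
    have h2 : ((m + 1).choose (j + 1) * (j + 1) : ℕ) * (j ! * (m - j)!) = (m + 1)! := by
      rw [← Nat.choose_mul_factorial_mul_factorial (show j + 1 ≤ m + 1 by omega), h1,
        Nat.factorial_succ j]
      ring
    rw [h1, Nat.add_sub_cancel, walkCount, excursionCount, ← h2]
    have h3 : ((m + 1).choose (j + 1) : ℚ) ≠ 0 := by
      exact_mod_cast (Nat.choose_pos (show j + 1 ≤ m + 1 by omega)).ne'
    have h4 : (j ! : ℚ) ≠ 0 := by exact_mod_cast j.factorial_ne_zero
    have h5 : ((m - j)! : ℚ) ≠ 0 := by exact_mod_cast (m - j).factorial_ne_zero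
    have h6 : ((j : ℚ) + 1) ≠ 0 := by positivity
    push_cast
    field_simp
  · simp

/-- Every edge is traversed back and forth, and every excursion has size at least one. This makes
the subtraction `l - i` in `excessGF` harmless and the sums over `R` finite. -/
theorem count_eq_zero (l : ℕ) :
    (∀ r m, (l < m ∨ l < r) → numExcursionFamilies r m l = 0) ∧
      ∀ k m, l < m → numWalkFamilies k m l = 0 := by
  induction l using Nat.strong_induction_on with
  | _ l ih =>
    have hB : ∀ r m, (l < m ∨ l < r) → numExcursionFamilies r m l = 0 := by
      rintro (_ | r) m h
      · rw [numExcursionFamilies_zero, if_neg (by omega)]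
      · rw [numExcursionFamilies_succ]
        refine Finset.sum_eq_zero fun s hs => ?_
        rw [Finset.mem_range] at hs
        refine mul_eq_zero_of_right _ (Finset.sum_eq_zero fun m₁ hm₁ => ?_)
        rw [Finset.mem_range] at hm₁
        rcases Nat.eq_zero_or_pos m₁ with rfl | hpos
        · simp
        refine mul_eq_zero_of_right _ (mul_eq_zero_of_right _ ?_)
        split_ifs with hsl
        · refine Finset.sum_eq_zero fun p hp => ?_
          rw [Finset.HasAntidiagonal.mem_antidiagonal] at hp
          by_cases h1 : p.1 < m₁ - 1
          · rw [(ih p.1 (by omega)).2 _ _ h1, zero_mul]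
          · rw [(ih p.2 (by omega)).1 _ _ (by omega), mul_zero]
        · rfl
    refine ⟨hB, fun k m h => ?_⟩
    rw [numWalkFamilies_eq_sum]
    exact Finset.sum_eq_zero fun R _ => by rw [hB R m (Or.inl h), mul_zero]

theorem walkCount_eq_zero {k m l : ℕ} (h : l < m) : walkCount k m l = 0 := by
  simp [walkCount, (count_eq_zero l).2 k m h]

theorem excursionCount_eq_zero {r m l : ℕ} (h : l < m ∨ l < r) : excursionCount r m l = 0 := by
  simp [excursionCount, (count_eq_zero l).1 r m h]

/-- The generating function `∑ U(m, l) x ^ (l - m) z ^ l`. -/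
def excessGF (U : ℕ → ℕ → ℚ) : ℚ⟦X⟧⟦X⟧ :=
  PowerSeries.mk fun l => PowerSeries.mk fun i => if i ≤ l then U (l - i) l else 0

/-- Length and number of vertices are additive, hence so is the excess. The vanishing hypotheses
justify reindexing by the number of vertices. -/
theorem coeff_excessGF_mul {U U' : ℕ → ℕ → ℚ} (hU : ∀ m l, l < m → U m l = 0)
    (hU' : ∀ m l, l < m → U' m l = 0) (i l : ℕ) :
    PowerSeries.coeff i (PowerSeries.coeff l (excessGF U * excessGF U')) =
      if i ≤ l then ∑ p ∈ Finset.HasAntidiagonal.antidiagonal l,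
        ∑ q ∈ Finset.HasAntidiagonal.antidiagonal (l - i), U q.1 p.1 * U' q.2 p.2 else 0 := by
  rw [PowerSeries.coeff_mul, map_sum]
  trans ∑ p ∈ Finset.HasAntidiagonal.antidiagonal l, if i ≤ l then
    ∑ q ∈ Finset.HasAntidiagonal.antidiagonal (l - i), U q.1 p.1 * U' q.2 p.2 else 0
  swap
  · split_ifs <;> simp
  refine Finset.sum_congr rfl fun p hp => ?_
  rw [Finset.HasAntidiagonal.mem_antidiagonal] at hp
  rw [PowerSeries.coeff_mul]
  simp only [excessGF, PowerSeries.coeff_mk]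
  split_ifs with hi
  · refine Finset.sum_bij_ne_zero (fun j _ _ => (p.1 - j.1, p.2 - j.2)) ?_ ?_ ?_ ?_
    · intro j hj hne
      rw [Finset.HasAntidiagonal.mem_antidiagonal] at hj ⊢
      have h1 : j.1 ≤ p.1 := by by_contra h; simp [h] at hne
      have h2 : j.2 ≤ p.2 := by by_contra h; simp [h] at hne
      simp only
      omega
    · intro j _ hne j' _ hne' h
      have h1 : j.1 ≤ p.1 := by by_contra h; simp [h] at hne
      have h2 : j.2 ≤ p.2 := by by_contra h; simp [h] at hne
      have h1' : j'.1 ≤ p.1 := by by_contra h; simp [h] at hne'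
      have h2' : j'.2 ≤ p.2 := by by_contra h; simp [h] at hne'
      simp only [Prod.mk.injEq] at h
      exact Prod.ext (by omega) (by omega)
    · intro q hq hne
      rw [Finset.HasAntidiagonal.mem_antidiagonal] at hq
      have h1 : q.1 ≤ p.1 := by by_contra h; exact hne (by rw [hU _ _ (by omega), zero_mul])
      have h2 : q.2 ≤ p.2 := by by_contra h; exact hne (by rw [hU' _ _ (by omega), mul_zero])
      have h3 : p.1 - (p.1 - q.1) = q.1 := by omega
      have h4 : p.2 - (p.2 - q.2) = q.2 := by omega
      refine ⟨(p.1 - q.1, p.2 - q.2), ?_, ?_, ?_⟩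
      · rw [Finset.HasAntidiagonal.mem_antidiagonal]
        simp only
        omega
      · simpa [h3, h4] using hne
      · simp [h3, h4]
    · intro j _ hne
      have h1 : j.1 ≤ p.1 := by by_contra h; simp [h] at hne
      have h2 : j.2 ≤ p.2 := by by_contra h; simp [h] at hne
      simp [h1, h2]
  · refine Finset.sum_eq_zero fun j hj => ?_
    rw [Finset.HasAntidiagonal.mem_antidiagonal] at hj
    by_cases h1 : j.1 ≤ p.1
    · rw [if_neg (show ¬ j.2 ≤ p.2 by omega), mul_zero]
    · rw [if_neg h1, zero_mul]

/-- The generating function of spanning `k`-tuples of closed walks. -/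
def walkGF (k : ℕ) : ℚ⟦X⟧⟦X⟧ := excessGF (walkCount k)

/-- The generating function of spanning `r`-tuples of excursions. -/
def excursionGF (r : ℕ) : ℚ⟦X⟧⟦X⟧ := excessGF (excursionCount r)

theorem coeff_excursionGF_eq_zero {r l : ℕ} (h : l < r) :
    PowerSeries.coeff l (excursionGF r) = 0 := by
  ext i
  simp [excursionGF, excessGF, excursionCount_eq_zero (Or.inr h)]

/-- Since `excursionGF R` is divisible by `z^R`, any truncation beyond `l` computes this coefficient
of the infinite sum over `R`. -/
theorem coeff_walkGF (k l : ℕ) {N : ℕ} (hN : l < N) :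
    PowerSeries.coeff l (walkGF k) =
      PowerSeries.coeff l (∑ R ∈ Finset.range N, (k.multichoose R : ℚ⟦X⟧⟦X⟧) * excursionGF R) := by
  have h : PowerSeries.coeff l (walkGF k) =
      ∑ R ∈ Finset.range (l + 1), (k.multichoose R : ℚ⟦X⟧) *
        PowerSeries.coeff l (excursionGF R) := by
    ext i
    simp only [walkGF, excursionGF, excessGF, PowerSeries.coeff_mk, map_sum, ← nsmul_eq_mul,
      map_nsmul]
    split_ifs
    · rw [walkCount_eq_sum]
      simp only [nsmul_eq_mul]
    · simp
  rw [h, map_sum, ← Finset.sum_subset (Finset.range_subset_range.2 (show l + 1 ≤ N by omega))]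
  · simp only [← nsmul_eq_mul, map_nsmul]
  · intro R _ hR
    rw [Finset.mem_range] at hR
    rw [← nsmul_eq_mul, map_nsmul, coeff_excursionGF_eq_zero (by omega), smul_zero]

/-- The `s + 1` excursions to the first child add `s + 1` to the length and one vertex, hence excess
`s`. -/
theorem excursionGF_succ (r : ℕ) :
    excursionGF (r + 1) = ∑ s ∈ Finset.range (r + 1), (r.choose s : ℚ⟦X⟧⟦X⟧) *
      (PowerSeries.X ^ (s + 1) * (PowerSeries.C (PowerSeries.X ^ s) *
        (walkGF (s + 1) * excursionGF (r - s)))) := by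
  ext l i
  simp only [map_sum, ← nsmul_eq_mul, map_nsmul]
  simp only [PowerSeries.coeff_X_pow_mul', apply_ite (PowerSeries.coeff i), map_zero,
    PowerSeries.coeff_C_mul]
  simp only [walkGF, excursionGF, coeff_excessGF_mul (fun _ _ => walkCount_eq_zero)
    (fun _ _ h => excursionCount_eq_zero (Or.inl h))]
  simp only [excessGF, PowerSeries.coeff_mk]
  by_cases hil : i < l
  · obtain ⟨m, rfl⟩ : ∃ m, l = m + 1 + i := ⟨l - i - 1, by omega⟩
    rw [if_pos hil.le, Nat.add_sub_cancel, excursionCount_succ_succ]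
    refine Finset.sum_congr rfl fun s _ => ?_
    rw [nsmul_eq_mul]
    congr 1
    by_cases hsl : s + 1 ≤ m + 1 + i
    · rw [if_pos hsl, if_pos hsl]
      by_cases hsi : s ≤ i
      · rw [if_pos hsi, if_pos (by omega), show m + 1 + i - (s + 1) - (i - s) = m by omega]
      -- For `s > i` the remaining vertices outnumber the remaining length, so one factor vanishes.
      · rw [if_neg hsi]
        refine Finset.sum_eq_zero fun p hp => Finset.sum_eq_zero fun q hq => ?_
        rw [Finset.HasAntidiagonal.mem_antidiagonal] at hp hq
        by_cases h : p.1 < q.1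
        · rw [walkCount_eq_zero h, zero_mul]
        · rw [excursionCount_eq_zero (Or.inl (by omega)), mul_zero]
    · rw [if_neg hsl, if_neg hsl]
  · have h0 : (if i ≤ l then excursionCount (r + 1) (l - i) l else 0) = 0 := by
      split_ifs
      · rw [show l - i = 0 by omega, excursionCount_succ_zero]
      · rfl
    rw [h0]
    symm
    refine Finset.sum_eq_zero fun s _ => ?_
    by_cases hsl : s + 1 ≤ l
    · rw [if_pos hsl]
      by_cases hsi : s ≤ i
      · rw [if_pos hsi, if_neg (by omega), smul_zero]
      · rw [if_neg hsi, smul_zero]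
    · rw [if_neg hsl, smul_zero]

/-- The contribution to the `(k + 1)`-tuples of closed walks of those whose first walk starts with
an excursion to a vertex that is visited `s + 1` times. -/
def walkGFTerm (k s : ℕ) : ℚ⟦X⟧⟦X⟧ :=
  ((k + s).choose s : ℚ⟦X⟧⟦X⟧) * (PowerSeries.X ^ (s + 1) * (PowerSeries.C (PowerSeries.X ^ s) *
    (walkGF (s + 1) * walkGF (k + 1 + s))))

theorem coeff_mul_congr {R : Type} [Semiring R] {G H : R⟦X⟧} (F : R⟦X⟧) {n l : ℕ}
    (h : ∀ j, j ≤ l → PowerSeries.coeff j G = PowerSeries.coeff j H) (hn : n ≤ l) :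
    PowerSeries.coeff n (F * G) = PowerSeries.coeff n (F * H) := by
  rw [PowerSeries.coeff_mul, PowerSeries.coeff_mul]
  refine Finset.sum_congr rfl fun p hp => ?_
  rw [Finset.HasAntidiagonal.mem_antidiagonal] at hp
  rw [h p.2 (by omega)]

/-- Both sides are the multinomial `(k+s+q)! / (k! s! q!)`. The right side lets the sum over `q` be
recognised as `walkGF (k + 1 + s)`. -/
theorem multichoose_mul_choose (k s q : ℕ) :
    (k + 1).multichoose (s + q) * (s + q).choose s =
      (k + s).choose s * (k + 1 + s).multichoose q := by
  rw [Nat.multichoose_eq, Nat.multichoose_eq, show k + 1 + (s + q) - 1 = k + s + q by omega,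
    show k + 1 + s + q - 1 = k + s + q by omega, Nat.choose_mul (Nat.le_add_right s q),
    show k + s + q - s = k + q by omega, Nat.add_sub_cancel_left]
  have h := Nat.choose_mul (n := k + s + q) (Nat.le_add_left s k)
  rw [show k + s + q - s = k + q by omega, Nat.add_sub_cancel,
    Nat.choose_symm_of_eq_add (show k + s + q = (k + s) + q by rfl),
    Nat.choose_symm_of_eq_add (show k + q = k + q by rfl)] at h
  rw [← h, mul_comm]

/-- Pascal's rule for `multichoose` separates the tuples whose first walk is trivial from the
others; in the latter, the first child is split off and the remaining excursions are resummed. -/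
theorem coeff_walkGF_succ (k l : ℕ) :
    PowerSeries.coeff l (walkGF (k + 1)) = PowerSeries.coeff l (walkGF k) +
      ∑ s ∈ Finset.range l, PowerSeries.coeff l (walkGFTerm k s) := by
  rw [coeff_walkGF (k + 1) l (Nat.lt_succ_self l), coeff_walkGF k l (Nat.lt_succ_self l),
    Finset.sum_range_succ', Finset.sum_range_succ']
  simp only [Nat.multichoose_succ_succ, Nat.cast_add, add_mul, Finset.sum_add_distrib,
    Nat.multichoose_zero_right]
  rw [add_right_comm, map_add]
  congr 1
  have h1 : ∀ R, ((k + 1).multichoose R : ℚ⟦X⟧⟦X⟧) * excursionGF (R + 1) =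
      ∑ s ∈ Finset.range (R + 1), (((k + 1).multichoose (s + (R - s)) *
        (s + (R - s)).choose s : ℕ) : ℚ⟦X⟧⟦X⟧) *
      (PowerSeries.X ^ (s + 1) * (PowerSeries.C (PowerSeries.X ^ s) *
        (walkGF (s + 1) * excursionGF (R - s)))) := by
    intro R
    rw [excursionGF_succ, Finset.mul_sum]
    refine Finset.sum_congr rfl fun s hs => ?_
    rw [Finset.mem_range] at hs
    rw [show s + (R - s) = R by omega, Nat.cast_mul]
    ring
  simp only [h1]
  rw [Finset.sum_range_diag_flip l (fun s q => (((k + 1).multichoose (s + q) *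
        (s + q).choose s : ℕ) : ℚ⟦X⟧⟦X⟧) *
      (PowerSeries.X ^ (s + 1) * (PowerSeries.C (PowerSeries.X ^ s) *
        (walkGF (s + 1) * excursionGF q)))), map_sum]
  refine Finset.sum_congr rfl fun s hs => ?_
  rw [Finset.mem_range] at hs
  have h2 : ∑ q ∈ Finset.range (l - s), (((k + 1).multichoose (s + q) *
        (s + q).choose s : ℕ) : ℚ⟦X⟧⟦X⟧) *
      (PowerSeries.X ^ (s + 1) * (PowerSeries.C (PowerSeries.X ^ s) *
        (walkGF (s + 1) * excursionGF q))) =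
      PowerSeries.X ^ (s + 1) * ((((k + s).choose s : ℚ⟦X⟧⟦X⟧) * PowerSeries.C (PowerSeries.X ^ s) *
        walkGF (s + 1)) * ∑ q ∈ Finset.range (l - s),
          ((k + 1 + s).multichoose q : ℚ⟦X⟧⟦X⟧) * excursionGF q) := by
    simp only [Finset.mul_sum, multichoose_mul_choose, Nat.cast_mul]
    refine Finset.sum_congr rfl fun q _ => ?_
    ring
  have h3 : walkGFTerm k s = PowerSeries.X ^ (s + 1) *
      ((((k + s).choose s : ℚ⟦X⟧⟦X⟧) * PowerSeries.C (PowerSeries.X ^ s) * walkGF (s + 1)) *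
        walkGF (k + 1 + s)) := by
    rw [walkGFTerm]
    ring
  rw [h2, h3, PowerSeries.coeff_X_pow_mul', PowerSeries.coeff_X_pow_mul', if_pos (by omega),
    if_pos (by omega)]
  refine coeff_mul_congr _ (l := l - (s + 1)) (fun j hj => ?_) le_rfl
  exact (coeff_walkGF _ j (by omega)).symm

theorem walkGF_zero : walkGF 0 = 1 := by
  ext l i
  have h : walkCount 0 (l - i) l = excursionCount 0 (l - i) l := by
    rw [walkCount_eq_sum, Finset.sum_range_succ']
    simp [Nat.multichoose_zero_succ]
  simp only [walkGF, excessGF, PowerSeries.coeff_mk, h, excursionCount, numExcursionFamilies_zero,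
    PowerSeries.coeff_one]
  by_cases hl : l = 0
  · subst hl
    by_cases hi : i = 0 <;> simp [hi, PowerSeries.coeff_one]
  · simp [hl]

/-- The term of index `s` carries `x^s`, so the infinite recursion can be stated as congruences
modulo `x^N`. -/
theorem X_pow_dvd_coeff_walkGF_sub (k N l : ℕ) :
    PowerSeries.X ^ N ∣ PowerSeries.coeff l
      (walkGF (k + 1) - (walkGF k + ∑ s ∈ Finset.range N, walkGFTerm k s)) := by
  have h1 : ∀ s, l ≤ s → PowerSeries.coeff l (walkGFTerm k s) = 0 := by
    intro s hs
    rw [walkGFTerm, ← nsmul_eq_mul, map_nsmul, PowerSeries.coeff_X_pow_mul', if_neg (by omega),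
      smul_zero]
  have h2 : ∀ s, N ≤ s → PowerSeries.X ^ N ∣ PowerSeries.coeff l (walkGFTerm k s) := by
    intro s hs
    rw [walkGFTerm, ← nsmul_eq_mul, map_nsmul, PowerSeries.coeff_X_pow_mul']
    split_ifs
    · rw [PowerSeries.coeff_C_mul, nsmul_eq_mul]
      exact ((pow_dvd_pow _ hs).trans (dvd_mul_right _ _)).mul_left _
    · simp
  have h3 : ∑ s ∈ Finset.range l, PowerSeries.coeff l (walkGFTerm k s) =
      ∑ s ∈ Finset.range (l + N), PowerSeries.coeff l (walkGFTerm k s) := by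
    refine Finset.sum_subset (Finset.range_subset_range.2 (by omega)) fun s _ hs => h1 s ?_
    simpa using hs
  rw [map_sub, map_add, map_sum, coeff_walkGF_succ, h3, add_sub_add_left_eq_sub, add_comm l N,
    Finset.sum_range_add, add_sub_cancel_left]
  exact Finset.dvd_sum fun s _ => h2 _ (Nat.le_add_right _ _)

/-- The `m + 1` possible starting vertices cancel one factor of the factorial. -/
theorem numTreeWalks_div_factorial (m l : ℕ) :
    (numTreeWalks (m + 1) (2 * l) : ℚ) / ((m + 1)! : ℕ) = walkCount 1 m l := by
  rw [numTreeWalks_even, walkCount, Nat.factorial_succ]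
  have : (m ! : ℚ) ≠ 0 := by exact_mod_cast m.factorial_ne_zero
  push_cast
  field_simp

theorem momentGF_eq_walkGF : momentGF = walkGF 1 := by
  ext l i
  rw [momentGF, PowerSeries.coeff_mk, formalMoment, Finset.sum_range_succ', numTreeWalks_zero,
    map_add, map_sum]
  simp only [Nat.cast_zero, zero_div, map_zero, add_zero, PowerSeries.coeff_monomial, walkGF,
    excessGF, PowerSeries.coeff_mk, numTreeWalks_div_factorial]
  split_ifs with hi
  · rw [Finset.sum_eq_single (l - i)]
    · rw [if_pos (by omega)]
    · intro m hm hne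
      rw [Finset.mem_range] at hm
      rw [if_neg (by omega)]
    · intro hni
      rw [Finset.mem_range] at hni
      omega
  · refine Finset.sum_eq_zero fun m hm => ?_
    rw [if_neg (by omega)]

/-! ### The scaled recursion as power series in `x = 1 / c` -/

/-- Exchange of the two variables. -/
def swapVars : ℚ⟦X⟧⟦X⟧ →+* ℚ⟦X⟧⟦X⟧ where
  toFun U := PowerSeries.mk fun i => PowerSeries.mk fun l =>
    PowerSeries.coeff i (PowerSeries.coeff l U)
  map_one' := by
    ext i l
    simp only [PowerSeries.coeff_mk, PowerSeries.coeff_one]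
    by_cases hi : i = 0 <;> by_cases hl : l = 0 <;> simp [hi, hl, PowerSeries.coeff_one]
  map_zero' := by
    ext i l
    simp
  map_add' U W := by
    ext i l
    simp
  map_mul' U W := by
    ext i l
    simp only [PowerSeries.coeff_mk, PowerSeries.coeff_mul, map_sum]
    rw [Finset.sum_comm]

theorem coeff_coeff_swapVars (U : ℚ⟦X⟧⟦X⟧) (i l : ℕ) :
    PowerSeries.coeff l (PowerSeries.coeff i (swapVars U)) =
      PowerSeries.coeff i (PowerSeries.coeff l U) := by
  simp [swapVars]

theorem swapVars_X : swapVars PowerSeries.X = PowerSeries.C PowerSeries.X := by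
  ext i l
  rw [coeff_coeff_swapVars, PowerSeries.coeff_X, PowerSeries.coeff_C]
  by_cases hi : i = 0 <;> by_cases hl : l = 1 <;>
    simp [hi, hl, PowerSeries.coeff_one, PowerSeries.coeff_X]

theorem swapVars_C_X : swapVars (PowerSeries.C PowerSeries.X) = PowerSeries.X := by
  ext i l
  rw [coeff_coeff_swapVars, PowerSeries.coeff_X, PowerSeries.coeff_C]
  by_cases hi : i = 1 <;> by_cases hl : l = 0 <;>
    simp [hi, hl, PowerSeries.coeff_one, PowerSeries.coeff_X]

theorem X_pow_dvd_swapVars {N : ℕ} {U : ℚ⟦X⟧⟦X⟧}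
    (h : ∀ l, PowerSeries.X ^ N ∣ PowerSeries.coeff l U) : PowerSeries.X ^ N ∣ swapVars U := by
  rw [PowerSeries.X_pow_dvd_iff]
  intro i hi
  ext l
  rw [coeff_coeff_swapVars, PowerSeries.X_pow_dvd_iff.1 (h l) i hi, map_zero]

theorem geomScaling_inv : geomScaling⁻¹ = 1 - PowerSeries.X := by
  rw [PowerSeries.inv_eq_iff_mul_eq_one (by simp [geomScaling]), mul_comm, geomScaling]
  exact PowerSeries.mk_one_mul_one_sub_eq_one ℚ

/-- The scaled generating function of spanning `k`-tuples of closed walks, as a power series in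
`x = 1 / c`. -/
def scaledWalkGF (k : ℕ) : ℚ⟦X⟧⟦X⟧ :=
  swapVars (PowerSeries.rescale (1 - PowerSeries.X : ℚ⟦X⟧) (walkGF k))

theorem coeffGF_eq (i : ℕ) :
    coeffGF geomScaling i = PowerSeries.coeff i (scaledWalkGF 1) := by
  ext l
  rw [coeffGF, PowerSeries.coeff_mk, scaledWalkGF, coeff_coeff_swapVars, scaledMomentGF,
    geomScaling_inv, momentGF_eq_walkGF]

theorem scaledWalkGF_zero : scaledWalkGF 0 = 1 := by
  rw [scaledWalkGF, walkGF_zero, map_one, map_one]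

/-- The image of the variable `z` under the scaling. -/
def scaledVar : ℚ⟦X⟧⟦X⟧ := PowerSeries.C PowerSeries.X * (1 - PowerSeries.X)

theorem swapVars_rescale_X :
    swapVars (PowerSeries.rescale (1 - PowerSeries.X : ℚ⟦X⟧) PowerSeries.X) = scaledVar := by
  rw [PowerSeries.rescale_X, map_mul, map_sub, map_sub, map_one, map_one, swapVars_X, swapVars_C_X,
    mul_comm, scaledVar]

theorem rescale_C (a b : ℚ⟦X⟧) :
    PowerSeries.rescale a (PowerSeries.C b) = PowerSeries.C b := by
  ext l
  rw [PowerSeries.coeff_rescale, PowerSeries.coeff_C]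
  split_ifs with h <;> simp [h]

/-- Scaling and exchange of variables are ring homomorphisms, so the recursion persists with `z`
replaced by `z (1 - x)`. -/
theorem X_pow_dvd_scaledWalkGF_sub (k N : ℕ) :
    PowerSeries.X ^ N ∣ scaledWalkGF (k + 1) - (scaledWalkGF k + ∑ s ∈ Finset.range N,
      ((k + s).choose s : ℚ⟦X⟧⟦X⟧) * (scaledVar ^ (s + 1) * (PowerSeries.X ^ s *
        (scaledWalkGF (s + 1) * scaledWalkGF (k + 1 + s))))) := by
  have h : scaledWalkGF (k + 1) - (scaledWalkGF k + ∑ s ∈ Finset.range N,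
      ((k + s).choose s : ℚ⟦X⟧⟦X⟧) * (scaledVar ^ (s + 1) * (PowerSeries.X ^ s *
        (scaledWalkGF (s + 1) * scaledWalkGF (k + 1 + s))))) =
      swapVars (PowerSeries.rescale (1 - PowerSeries.X : ℚ⟦X⟧)
        (walkGF (k + 1) - (walkGF k + ∑ s ∈ Finset.range N, walkGFTerm k s))) := by
    simp only [map_sub, map_add, map_sum, walkGFTerm, map_mul, map_natCast, map_pow,
      swapVars_rescale_X, rescale_C, swapVars_C_X, scaledWalkGF]
  rw [h]
  refine X_pow_dvd_swapVars fun l => ?_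
  rw [PowerSeries.coeff_rescale]
  exact (X_pow_dvd_coeff_walkGF_sub k N l).mul_left _


/-! ### The structure of the coefficients -/

theorem catGF_eq : catGF = 1 + PowerSeries.X * catGF ^ 2 := by
  ext n
  cases n with
  | zero => simp [catGF]
  | succ n =>
    rw [map_add, PowerSeries.coeff_succ_X_mul, sq, PowerSeries.coeff_mul, PowerSeries.coeff_one,
      if_neg n.succ_ne_zero, zero_add]
    simp only [catGF, PowerSeries.coeff_mk]
    rw [catalan_succ']
    push_cast
    rfl

theorem catGF_eq_one_add_zCsq : catGF = 1 + zCsq := catGF_eq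

theorem constantCoeff_zCsq : PowerSeries.constantCoeff zCsq = 0 := by
  simp [zCsq]

theorem one_sub_zCsq_ne_zero : 1 - zCsq ≠ 0 := fun h => by
  have := congrArg PowerSeries.constantCoeff h
  simp [constantCoeff_zCsq] at this

theorem eq_catGF {c : ℚ⟦X⟧} (hc : c = 1 + PowerSeries.X * c ^ 2) : c = catGF := by
  have h : (c - catGF) * (1 - PowerSeries.X * (c + catGF)) = 0 := by
    linear_combination hc - catGF_eq
  rcases mul_eq_zero.1 h with h | h
  · exact sub_eq_zero.1 h
  · have := congrArg PowerSeries.constantCoeff h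
    simp at this

/-- The polynomials in `z C(z) ^ 2`. -/
def zCsqAlgebra : Subalgebra ℚ ℚ⟦X⟧ := (Polynomial.aeval zCsq : ℚ[X] →ₐ[ℚ] ℚ⟦X⟧).range

theorem zCsq_mem : zCsq ∈ zCsqAlgebra := ⟨Polynomial.X, by simp⟩

theorem one_sub_zCsq_mem : 1 - zCsq ∈ zCsqAlgebra := sub_mem (one_mem _) zCsq_mem

/-- For `i < n` the coefficient of index `i` of `U` is a polynomial in `y = z C(z) ^ 2` divided by
`(1 - y) ^ (i - 2)`. -/
def PoleBound (n : ℕ) (U : ℚ⟦X⟧⟦X⟧) : Prop :=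
  ∀ i < n, (1 - zCsq) ^ (i - 2) * PowerSeries.coeff i U ∈ zCsqAlgebra

namespace PoleBound

variable {n : ℕ} {U W : ℚ⟦X⟧⟦X⟧}

theorem congr (hU : PoleBound n U) (h : PowerSeries.X ^ n ∣ W - U) : PoleBound n W := by
  intro i hi
  have := PowerSeries.X_pow_dvd_iff.1 h i hi
  rw [map_sub, sub_eq_zero] at this
  rw [this]
  exact hU i hi

theorem add (hU : PoleBound n U) (hW : PoleBound n W) : PoleBound n (U + W) := by
  intro i hi
  rw [map_add, mul_add]
  exact add_mem (hU i hi) (hW i hi)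

theorem sub (hU : PoleBound n U) (hW : PoleBound n W) : PoleBound n (U - W) := by
  intro i hi
  rw [map_sub, mul_sub]
  exact sub_mem (hU i hi) (hW i hi)

/-- Truncated subtraction gives `(p - 2) + (q - 2) ≤ p + q - 2`. -/
theorem mul (hU : PoleBound n U) (hW : PoleBound n W) : PoleBound n (U * W) := by
  intro i hi
  rw [PowerSeries.coeff_mul, Finset.mul_sum]
  refine sum_mem fun p hp => ?_
  rw [Finset.HasAntidiagonal.mem_antidiagonal] at hp
  have h : (1 - zCsq) ^ (i - 2) * (PowerSeries.coeff p.1 U * PowerSeries.coeff p.2 W) =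
      (1 - zCsq) ^ (i - 2 - ((p.1 - 2) + (p.2 - 2))) *
        (((1 - zCsq) ^ (p.1 - 2) * PowerSeries.coeff p.1 U) *
          ((1 - zCsq) ^ (p.2 - 2) * PowerSeries.coeff p.2 W)) := by
    rw [show (1 - zCsq) ^ (i - 2) = (1 - zCsq) ^ (i - 2 - ((p.1 - 2) + (p.2 - 2))) *
      ((1 - zCsq) ^ (p.1 - 2) * (1 - zCsq) ^ (p.2 - 2)) by
        rw [← pow_add, ← pow_add]; congr 1; omega]
    ring
  rw [h]
  exact mul_mem (pow_mem one_sub_zCsq_mem _) (mul_mem (hU _ (by omega)) (hW _ (by omega)))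

theorem C {c : ℚ⟦X⟧} (hc : c ∈ zCsqAlgebra) : PoleBound n (PowerSeries.C c) := by
  intro i _
  rw [PowerSeries.coeff_C]
  split_ifs
  · exact mul_mem (pow_mem one_sub_zCsq_mem _) hc
  · rw [mul_zero]
    exact zero_mem _

theorem one : PoleBound n 1 := by
  rw [← map_one PowerSeries.C]
  exact PoleBound.C (one_mem _)

theorem natCast (k : ℕ) : PoleBound n (k : ℚ⟦X⟧⟦X⟧) := by
  rw [← map_natCast PowerSeries.C k]
  exact PoleBound.C (natCast_mem _ k)

theorem X : PoleBound n PowerSeries.X := by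
  intro i _
  rw [PowerSeries.coeff_X]
  split_ifs
  · exact mul_mem (pow_mem one_sub_zCsq_mem _) (one_mem _)
  · rw [mul_zero]
    exact zero_mem _

theorem pow (hU : PoleBound n U) (k : ℕ) : PoleBound n (U ^ k) := by
  induction k with
  | zero => simpa using one
  | succ k ih =>
    rw [pow_succ]
    exact ih.mul hU

theorem sum {ι : Type} {s : Finset ι} {F : ι → ℚ⟦X⟧⟦X⟧} (h : ∀ j ∈ s, PoleBound n (F j)) :
    PoleBound n (∑ j ∈ s, F j) := by
  intro i hi
  rw [map_sum, Finset.mul_sum]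
  exact sum_mem fun j hj => h j hj i hi

theorem X_mul (hU : PoleBound n U) : PoleBound (n + 1) (PowerSeries.X * U) := by
  rintro (_ | i) hi
  · simp
  · rw [PowerSeries.coeff_succ_X_mul,
      show (1 - zCsq) ^ (i + 1 - 2) = (1 - zCsq) ^ (i + 1 - 2 - (i - 2)) * (1 - zCsq) ^ (i - 2) by
        rw [← pow_add]; congr 1; omega, mul_assoc]
    exact mul_mem (pow_mem one_sub_zCsq_mem _) (hU i (by omega))

end PoleBound

/-- The normalized recursion: `g k` plays the role of `f k / A ^ k`, where `A = C a` is the inverse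
of `1 - Z f 1`, and `w = Z A ^ 2`. -/
structure NormalizedSystem (a w : ℚ⟦X⟧⟦X⟧) (g : ℕ → ℚ⟦X⟧⟦X⟧) : Prop where
  g_zero : g 0 = 1
  w_eq : w = PowerSeries.C zCsq * (1 - PowerSeries.X) * a ^ 2
  a_eq : PowerSeries.C (1 + zCsq) * a = 1 + w * g 1
  a_zero : PowerSeries.constantCoeff a = 1
  dvd : ∀ k N, PowerSeries.X ^ (N + 1) ∣ g (k + 1) - (g k + PowerSeries.X *
    ∑ s ∈ Finset.range N, ((k + (s + 1)).choose (s + 1) : ℚ⟦X⟧⟦X⟧) * (w ^ (s + 2) *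
      (PowerSeries.X ^ s * (g (s + 2) * g (k + 2 + s)))))

namespace NormalizedSystem

variable {a w : ℚ⟦X⟧⟦X⟧} {g : ℕ → ℚ⟦X⟧⟦X⟧}

theorem constantCoeff_g (H : NormalizedSystem a w g) (k : ℕ) :
    PowerSeries.constantCoeff (g k) = 1 := by
  induction k with
  | zero => simp [H.g_zero]
  | succ k ih =>
    have := H.dvd k 0
    rw [zero_add, pow_one, PowerSeries.X_dvd_iff] at this
    simpa [ih, sub_eq_zero] using this

/-- For `k = 0` all binomials are `1` and the two `g` factors coincide, so the recursion divided by
`x` is a sum of squares. -/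
theorem exists_eq (H : NormalizedSystem a w g) :
    ∃ h : ℚ⟦X⟧⟦X⟧, g 1 = 1 + PowerSeries.X * h ∧ ∀ N, PowerSeries.X ^ N ∣
      h - ∑ s ∈ Finset.range N, w ^ (s + 2) * (PowerSeries.X ^ s * g (s + 2) ^ 2) := by
  have h1 : PowerSeries.X ∣ g 1 - 1 := by
    rw [PowerSeries.X_dvd_iff, map_sub, H.constantCoeff_g, map_one, sub_self]
  obtain ⟨h, hh⟩ := h1
  refine ⟨h, by linear_combination hh, fun N => ?_⟩
  have h2 := H.dvd 0 N
  rw [pow_succ', H.g_zero] at h2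
  refine (mul_dvd_mul_iff_left (PowerSeries.X_ne_zero (R := ℚ⟦X⟧))).1 ?_
  convert h2 using 1
  rw [zero_add, sub_add_eq_sub_sub, hh, mul_sub]
  congr 2
  refine Finset.sum_congr rfl fun s _ => ?_
  rw [zero_add, Nat.choose_self, Nat.cast_one, one_mul, add_comm (0 + 2) s, zero_add, sq]

/-- The linear part of `a^2` contributes `2 y β`, which turns `1 + y` into `1 - y`: the only source
of poles. The summand `-1` comes from the factor `1 - x` in `w`. -/
theorem quadratic (H : NormalizedSystem a w g) {h β : ℚ⟦X⟧⟦X⟧} (hg : g 1 = 1 + PowerSeries.X * h)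
    (ha : a = 1 + PowerSeries.X * β) :
    PowerSeries.C (1 - zCsq) * β = PowerSeries.C zCsq *
      (PowerSeries.X * β ^ 2 + a ^ 2 * (h - 1 - PowerSeries.X * h)) := by
  have h1 := H.a_eq
  rw [H.w_eq, hg] at h1
  refine mul_left_cancel₀ (PowerSeries.X_ne_zero (R := ℚ⟦X⟧)) ?_
  rw [ha] at h1 ⊢
  simp only [map_add, map_sub, map_one] at h1 ⊢
  linear_combination h1

theorem poleBound_g (H : NormalizedSystem a w g) {n : ℕ} (ha : PoleBound n a)
    (hg : ∀ k, PoleBound n (g k)) (k : ℕ) : PoleBound (n + 1) (g k) := by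
  have hw : PoleBound n w := by
    rw [H.w_eq]
    exact ((PoleBound.C zCsq_mem).mul (PoleBound.one.sub PoleBound.X)).mul (ha.pow 2)
  induction k with
  | zero =>
    rw [H.g_zero]
    exact PoleBound.one
  | succ k ih =>
    refine (ih.add (PoleBound.X_mul ?_)).congr (H.dvd k n)
    exact PoleBound.sum fun s _ => (PoleBound.natCast _).mul
      ((hw.pow _).mul ((PoleBound.X.pow _).mul ((hg _).mul (hg _))))

/-- At orders 0 and 1 the right side of `quadratic` is `y (y^2 - 1)` and `y^2 (2 - 3 y^2 + y^3)`.
Both vanish at `y = 1`, so no pole appears yet; this is the effect of the chosen scaling. -/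
theorem first_coeffs (H : NormalizedSystem a w g) {h β : ℚ⟦X⟧⟦X⟧}
    (hg : g 1 = 1 + PowerSeries.X * h)
    (hh : ∀ N, PowerSeries.X ^ N ∣
      h - ∑ s ∈ Finset.range N, w ^ (s + 2) * (PowerSeries.X ^ s * g (s + 2) ^ 2))
    (ha : a = 1 + PowerSeries.X * β) :
    PowerSeries.coeff 0 β = -(zCsq * (1 + zCsq)) ∧
      PowerSeries.coeff 1 β = zCsq ^ 2 * (2 + 2 * zCsq - zCsq ^ 2) := by
  have hw0 : PowerSeries.coeff 0 w = zCsq := by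
    simp [H.w_eq, H.a_zero]
  have hg0 : ∀ k, PowerSeries.coeff 0 (g k) = 1 := fun k => by
    simp [H.constantCoeff_g]
  have ha0 : PowerSeries.coeff 0 a = 1 := by simp [H.a_zero]
  have hh0 : PowerSeries.coeff 0 h = zCsq ^ 2 := by
    have := PowerSeries.X_pow_dvd_iff.1 (hh 1) 0 one_pos
    rw [map_sub, sub_eq_zero] at this
    rw [this]
    simp only [PowerSeries.coeff_zero_eq_constantCoeff] at hw0
    simp [hw0, H.constantCoeff_g]
  have hq := H.quadratic hg ha
  have hβ0 : PowerSeries.coeff 0 β = -(zCsq * (1 + zCsq)) := by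
    have := congrArg (PowerSeries.coeff 0) hq
    simp only [PowerSeries.coeff_zero_eq_constantCoeff] at this hh0 ⊢
    simp [hh0, H.a_zero] at this
    refine mul_left_cancel₀ one_sub_zCsq_ne_zero ?_
    linear_combination this
  refine ⟨hβ0, ?_⟩
  have ha1 : PowerSeries.coeff 1 a = PowerSeries.coeff 0 β := by
    rw [ha, map_add, PowerSeries.coeff_succ_X_mul, PowerSeries.coeff_one]
    simp
  have hw1 : PowerSeries.coeff 1 w = zCsq * (2 * PowerSeries.coeff 0 β - 1) := by
    rw [H.w_eq, mul_assoc, PowerSeries.coeff_C_mul, PowerSeries.coeff_one_mul,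
      PowerSeries.coeff_one_pow, ha1]
    simp [H.a_zero, PowerSeries.coeff_one, -mul_eq_mul_left_iff]
    ring
  have hg1 : PowerSeries.coeff 1 (g 1) = zCsq ^ 2 := by
    rw [hg, map_add, PowerSeries.coeff_succ_X_mul, PowerSeries.coeff_one, hh0]
    simp
  have hg2 : PowerSeries.coeff 1 (g 2) = 3 * zCsq ^ 2 := by
    have := PowerSeries.X_pow_dvd_iff.1 (H.dvd 1 1) 1 one_lt_two
    rw [map_sub, sub_eq_zero] at this
    rw [this, map_add, PowerSeries.coeff_succ_X_mul, hg1]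
    simp only [PowerSeries.coeff_zero_eq_constantCoeff] at hw0 ⊢
    simp [hw0, H.constantCoeff_g, map_ofNat]
    ring
  have hh1 : PowerSeries.coeff 1 h =
      2 * zCsq ^ 2 * (2 * PowerSeries.coeff 0 β - 1) + 6 * zCsq ^ 4 + zCsq ^ 3 := by
    have := PowerSeries.X_pow_dvd_iff.1 (hh 2) 1 one_lt_two
    rw [map_sub, sub_eq_zero] at this
    rw [this, Finset.sum_range_succ, Finset.sum_range_one, map_add]
    have e1 : w ^ (1 + 2) * (PowerSeries.X ^ 1 * g (1 + 2) ^ 2) =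
        PowerSeries.X * (w ^ 3 * g 3 ^ 2) := by ring
    have e0 : w ^ (0 + 2) * (PowerSeries.X ^ 0 * g (0 + 2) ^ 2) = w ^ 2 * g 2 ^ 2 := by ring
    rw [e0, e1, PowerSeries.coeff_succ_X_mul, PowerSeries.coeff_one_mul, PowerSeries.coeff_one_pow,
      PowerSeries.coeff_one_pow, hw1, hg2]
    simp only [PowerSeries.coeff_zero_eq_constantCoeff] at hw0 ⊢
    simp [hw0, H.constantCoeff_g]
    ring
  have hX : ∀ U : ℚ⟦X⟧⟦X⟧, PowerSeries.coeff 1 (PowerSeries.X * U) = PowerSeries.coeff 0 U :=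
    fun U => PowerSeries.coeff_succ_X_mul 0 U
  have hd : PowerSeries.coeff 1 (h - 1 - PowerSeries.X * h) =
      PowerSeries.coeff 1 h - PowerSeries.coeff 0 h := by
    rw [map_sub, map_sub, hX, PowerSeries.coeff_one, if_neg one_ne_zero, sub_zero]
  have := congrArg (PowerSeries.coeff 1) hq
  rw [PowerSeries.coeff_C_mul, PowerSeries.coeff_C_mul, map_add, hX,
    PowerSeries.coeff_one_mul, PowerSeries.coeff_one_pow, hd, ha1, hh1, hh0] at this
  simp only [PowerSeries.coeff_zero_eq_constantCoeff] at this hh0 hβ0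
  simp [H.a_zero, hh0, hβ0, -mul_eq_mul_left_iff] at this
  refine mul_left_cancel₀ one_sub_zCsq_ne_zero ?_
  linear_combination this

/-- Coefficients up to index 2 are polynomials by `first_coeffs`. Beyond, `quadratic` expresses the
next one by known coefficients, with a single new division by `1 - y`. -/
theorem poleBound_a (H : NormalizedSystem a w g) {n : ℕ} (ha : PoleBound n a)
    (hg : ∀ k, PoleBound n (g k)) : PoleBound (n + 1) a := by
  obtain ⟨h, hg1, hh⟩ := H.exists_eq
  have hXa : PowerSeries.X ∣ a - 1 := by
    rw [PowerSeries.X_dvd_iff, map_sub, H.a_zero, map_one, sub_self]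
  obtain ⟨β, hβ⟩ := hXa
  have haβ : a = 1 + PowerSeries.X * β := by linear_combination hβ
  have hcoeff : ∀ j, PowerSeries.coeff (j + 1) a = PowerSeries.coeff j β := fun j => by
    rw [haβ, map_add, PowerSeries.coeff_succ_X_mul, PowerSeries.coeff_one,
      if_neg j.succ_ne_zero, zero_add]
  obtain ⟨hβ0, hβ1⟩ := H.first_coeffs hg1 hh haβ
  have hw : PoleBound n w := by
    rw [H.w_eq]
    exact ((PoleBound.C zCsq_mem).mul (PoleBound.one.sub PoleBound.X)).mul (ha.pow 2)
  have hh' : PoleBound n h := by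
    refine PoleBound.congr (PoleBound.sum fun s _ => ?_) (hh n)
    exact (hw.pow _).mul ((PoleBound.X.pow _).mul ((hg _).pow _))
  intro i hi
  rcases Nat.lt_succ_iff_lt_or_eq.1 hi with hi | rfl
  · exact ha i hi
  rcases i with _ | _ | _ | i
  · simp [H.a_zero, one_mem]
  · rw [hcoeff, hβ0]
    simpa using mul_mem zCsq_mem (add_mem (one_mem _) zCsq_mem)
  · rw [hcoeff, hβ1]
    have h2 : (2 : ℚ⟦X⟧) ∈ zCsqAlgebra := ofNat_mem _ 2
    simpa using mul_mem (pow_mem zCsq_mem 2)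
      (sub_mem (add_mem h2 (mul_mem h2 zCsq_mem)) (pow_mem zCsq_mem 2))
  · have hq := congrArg (PowerSeries.coeff (i + 2)) (H.quadratic hg1 haβ)
    rw [PowerSeries.coeff_C_mul, PowerSeries.coeff_C_mul, map_add,
      PowerSeries.coeff_succ_X_mul] at hq
    rw [hcoeff, show i + 1 + 1 + 1 - 2 = i + 1 by omega, pow_succ, mul_assoc, hq, mul_left_comm,
      mul_add]
    refine mul_mem zCsq_mem (add_mem ?_ ?_)
    -- Indices of `β` are those of `a` lowered by one. As they sum to `i + 1` here, the two pole
    -- orders sum to at most `i`, even if one index is `0`.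
    · rw [sq, PowerSeries.coeff_mul, Finset.mul_sum]
      refine sum_mem fun p hp => ?_
      rw [Finset.HasAntidiagonal.mem_antidiagonal] at hp
      have h1 := ha (p.1 + 1) (by omega)
      have h2 := ha (p.2 + 1) (by omega)
      rw [hcoeff] at h1 h2
      rw [show (1 - zCsq) ^ i = (1 - zCsq) ^ (i - ((p.1 + 1 - 2) + (p.2 + 1 - 2))) *
        ((1 - zCsq) ^ (p.1 + 1 - 2) * (1 - zCsq) ^ (p.2 + 1 - 2)) by
          rw [← pow_add, ← pow_add]; congr 1; omega, mul_assoc, mul_mul_mul_comm]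
      exact mul_mem (pow_mem one_sub_zCsq_mem _) (mul_mem h1 h2)
    · have h3 : PoleBound (i + 1 + 1 + 1) (a ^ 2 * (h - 1 - PowerSeries.X * h)) :=
        (ha.pow 2).mul ((hh'.sub PoleBound.one).sub (PoleBound.X.mul hh'))
      exact h3 (i + 2) (by omega)

theorem poleBound (H : NormalizedSystem a w g) (n : ℕ) :
    PoleBound n a ∧ ∀ k, PoleBound n (g k) := by
  induction n with
  | zero => exact ⟨fun i hi => absurd hi (Nat.not_lt_zero i),
      fun k i hi => absurd hi (Nat.not_lt_zero i)⟩
  | succ n ih => exact ⟨H.poleBound_a ih.1 ih.2, H.poleBound_g ih.1 ih.2⟩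

end NormalizedSystem

/-- At `x = 0` only `s = 0` survives, leaving the Catalan equation. -/
theorem constantCoeff_scaledWalkGF_one : PowerSeries.constantCoeff (scaledWalkGF 1) = catGF := by
  have := X_pow_dvd_scaledWalkGF_sub 0 1
  rw [pow_one, PowerSeries.X_dvd_iff] at this
  refine eq_catGF ?_
  simp [scaledWalkGF_zero, scaledVar] at this
  linear_combination this

theorem exists_normalizedSystem : ∃ (a w : ℚ⟦X⟧⟦X⟧) (g : ℕ → ℚ⟦X⟧⟦X⟧), NormalizedSystem a w g ∧
    scaledWalkGF 1 = PowerSeries.C catGF * (a * g 1) := by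
  set f := scaledWalkGF with hf
  set B := 1 - scaledVar * f 1 with hB
  -- At `x = 0` this is `C (1 - z C) = 1`, so `a` has constant term `1`.
  have hunit : PowerSeries.constantCoeff (PowerSeries.C catGF * B) = 1 := by
    simp only [hB, hf, map_mul, map_sub, map_one, constantCoeff_scaledWalkGF_one, scaledVar,
      PowerSeries.constantCoeff_C, PowerSeries.constantCoeff_X]
    linear_combination catGF_eq
  obtain ⟨a, ha⟩ := (PowerSeries.isUnit_iff_constantCoeff.2
    (hunit ▸ isUnit_one :
      IsUnit (PowerSeries.constantCoeff (PowerSeries.C catGF * B)))).exists_right_inv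
  set A := PowerSeries.C catGF * a with hA
  have hAB : A * B = 1 := by rw [← ha]; ring
  have ha0 : PowerSeries.constantCoeff a = 1 := by
    have := congrArg PowerSeries.constantCoeff ha
    rwa [map_mul, hunit, one_mul, map_one] at this
  have hABn : ∀ n, A ^ n * B ^ n = 1 := fun n => by rw [← mul_pow, hAB, one_pow]
  have hf1 : f 1 = A * (f 1 * B ^ 1) := by linear_combination -(f 1) * hAB
  refine ⟨a, scaledVar * A ^ 2, fun k => f k * B ^ k, ⟨?_, ?_, ?_, ha0, ?_⟩, ?_⟩
  · simp [hf, scaledWalkGF_zero]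
  · simp only [hA, scaledVar, zCsq, map_mul, map_pow]
    ring
  · rw [← catGF_eq_one_add_zCsq, ← hA]
    linear_combination hAB + A * hB + scaledVar * A * f 1 * (-hAB)
  · intro k N
    have h := (X_pow_dvd_scaledWalkGF_sub k (N + 1)).mul_left (B ^ k)
    convert h using 1
    rw [Finset.sum_range_succ', ← hf]
    have hsum : B ^ k * ∑ s ∈ Finset.range N, ((k + (s + 1)).choose (s + 1) : ℚ⟦X⟧⟦X⟧) *
        (scaledVar ^ (s + 1 + 1) * (PowerSeries.X ^ (s + 1) *
          (f (s + 1 + 1) * f (k + 1 + (s + 1))))) = PowerSeries.X *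
        ∑ s ∈ Finset.range N, ((k + (s + 1)).choose (s + 1) : ℚ⟦X⟧⟦X⟧) *
          ((scaledVar * A ^ 2) ^ (s + 2) * (PowerSeries.X ^ s *
            (f (s + 2) * B ^ (s + 2) * (f (k + 2 + s) * B ^ (k + 2 + s))))) := by
      rw [Finset.mul_sum, Finset.mul_sum]
      refine Finset.sum_congr rfl fun s _ => ?_
      rw [show k + 1 + (s + 1) = k + 2 + s by ring]
      have e : (A ^ 2) ^ (s + 2) * (B ^ (s + 2) * B ^ (k + 2 + s)) = B ^ k := by
        have e' : B ^ (s + 2) * B ^ (k + 2 + s) = B ^ (2 * (s + 2)) * B ^ k := by ring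
        rw [e', ← pow_mul, ← mul_assoc, hABn, one_mul]
      rw [← e]
      ring
    rw [mul_sub, mul_add, mul_add, hsum]
    simp only [add_zero, Nat.choose_zero_right, Nat.cast_one, zero_add, pow_one, pow_zero]
    -- The term `s = 0` is `Z f_1 f_{k+1}`; subtracted from `f_{k+1}` it leaves `B f_{k+1}`.
    linear_combination (f (k + 1) * B ^ k) * hB
  · rw [hf1]
    simp only [hA]
    ring

/-- `V̂ᵢ / C` is a polynomial in `y = z C ^ 2` divided by `(1 - y) ^ (i - 2)`. -/
theorem exists_polynomial (i : ℕ) : ∃ Q : ℚ[X],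
    (1 - zCsq) ^ (i - 2) * coeffGF geomScaling i = catGF * Polynomial.aeval zCsq Q := by
  obtain ⟨a, w, g, H, hf⟩ := exists_normalizedSystem
  obtain ⟨Q, hQ⟩ := ((H.poleBound (i + 1)).1.mul ((H.poleBound (i + 1)).2 1)) i (Nat.lt_succ_self i)
  refine ⟨Q, ?_⟩
  have hQ : Polynomial.aeval zCsq Q = _ := hQ
  rw [coeffGF_eq, hf, PowerSeries.coeff_C_mul, hQ]
  ring

theorem coeffGF_of_le_two {i : ℕ} (hi : i ≤ 2) : ∃ Q : ℚ[X],
    coeffGF geomScaling i = catGF * Polynomial.aeval zCsq Q := by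
  obtain ⟨Q, hQ⟩ := exists_polynomial i
  refine ⟨Q, ?_⟩
  rwa [Nat.sub_eq_zero_of_le hi, pow_zero, one_mul] at hQ

theorem coeffGF_of_three_le {i : ℕ} (hi : 3 ≤ i) : ∃ Q : ℚ[X],
    coeffGF geomScaling i =
      catGF * Polynomial.aeval zCsq Q * ((1 - zCsq) ^ (2 * i - 3))⁻¹ := by
  obtain ⟨Q, hQ⟩ := exists_polynomial i
  -- The actual pole order is at most `i - 2`; the extra factor pads it to `2 * i - 3`.
  refine ⟨Q * (1 - Polynomial.X) ^ (i - 1), ?_⟩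
  rw [PowerSeries.eq_mul_inv_iff_mul_eq (by simp [constantCoeff_zCsq]),
    show 2 * i - 3 = (i - 2) + (i - 1) by omega, pow_add]
  simp only [map_mul, map_pow, map_sub, map_one, Polynomial.aeval_X]
  linear_combination (1 - zCsq) ^ (i - 1) * hQ


/-! ### Limits of the moments of the random graph -/

theorem sum_eigenvalues_pow {ι : Type} [Fintype ι] [DecidableEq ι] {A : Matrix ι ι ℝ}
    (hA : A.IsHermitian) (k : ℕ) : ∑ i, hA.eigenvalues i ^ k = (A ^ k).trace := by
  conv_rhs => rw [hA.spectral_theorem, ← map_pow, Unitary.conjStarAlgAut_apply,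
    Matrix.trace_mul_comm, ← mul_assoc, Matrix.diagonal_pow]
  simp [Matrix.trace_diagonal]

theorem trace_adjMatrix_pow {n : ℕ} (G : SimpleGraph (Fin n)) [DecidableRel G.Adj] (k : ℕ) :
    ((G.adjMatrix ℝ) ^ k).trace =
      {l | l ∈ closedWords (Fin n) k ∧ wordEdges l ⊆ G.edgeSet}.ncard := by
  have h : (∑ u, Fintype.card {p : G.Walk u u | p.length = k}) =
      {l | l ∈ closedWords (Fin n) k ∧ wordEdges l ⊆ G.edgeSet}.ncard := by
    rw [← Fintype.card_sigma, ← Nat.card_eq_fintype_card, ← Nat.card_coe_set_eq]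
    refine Nat.card_congr (Equiv.ofBijective (fun W => ⟨W.2.1.support, ?_⟩) ⟨?_, ?_⟩)
    · obtain ⟨u, p, rfl⟩ := W
      refine ⟨?_, ?_⟩
      · have := support_mem_closedWords ⟨u, p.mapLe le_top⟩
        simpa using this
      · rw [wordEdges_support]
        exact fun e he => p.edges_subset_edgeSet he
    · rintro ⟨u, p, hp⟩ ⟨v, q, hq⟩ h
      have h : p.support = q.support := congrArg Subtype.val h
      obtain rfl : u = v := by
        rw [← p.head_support, ← q.head_support]
        simp only [h]
      obtain rfl := SimpleGraph.Walk.ext_support h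
      rfl
    · rintro ⟨l, hl, he⟩
      obtain ⟨W, hW, rfl⟩ := exists_walk_of_mem_closedWords hl
      rw [wordEdges_support] at he
      refine ⟨⟨W.1, W.2.transfer G he, (W.2.length_transfer he).trans hW⟩, ?_⟩
      exact Subtype.ext (W.2.support_transfer he)
  rw [← h, Matrix.trace]
  push_cast
  refine Finset.sum_congr rfl fun u _ => ?_
  rw [Matrix.diag_apply, SimpleGraph.adjMatrix_pow_apply_eq_card_walk]

open Classical in
theorem spectralMoment_eq_sum {n : ℕ} (s : ℝ) (G : SimpleGraph (Fin n)) (k : ℕ) :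
    spectralMoment s G k = s ^ k / n *
      ∑ l ∈ (finite_closedWords (V := Fin n) k).toFinset,
        if wordEdges l ⊆ G.edgeSet then 1 else 0 := by
  have h : {l | l ∈ closedWords (Fin n) k ∧ wordEdges l ⊆ G.edgeSet} =
      ↑((finite_closedWords (V := Fin n) k).toFinset.filter fun l => wordEdges l ⊆ G.edgeSet) := by
    ext l
    simp
  rw [spectralMoment, sum_eigenvalues_pow, scaledAdj, smul_pow, Matrix.trace_smul,
    trace_adjMatrix_pow, smul_eq_mul, Finset.sum_boole, h, Set.ncard_coe_finset]
  ring

open Classical in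
-- Graphs containing `E` are `E` together with an arbitrary set of other pairs; the weights of the
-- latter sum to `1` by the binomial theorem.
theorem sum_binomialRandom_mul_indicator {V : Type} [Finite V]
    [Fintype (SimpleGraph V)] (p : unitInterval)
    {E : Set (Sym2 V)} (hE : E ⊆ Sym2.diagSetᶜ) :
    ∑ G : SimpleGraph V, (SimpleGraph.binomialRandom V p).real {G} *
      (if E ⊆ G.edgeSet then 1 else 0) = (p : ℝ) ^ E.ncard := by
  have := Fintype.ofFinite V
  set D : Finset (Sym2 V) := (Sym2.diagSetᶜ : Set (Sym2 V)).toFinset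
  set F : Finset (Sym2 V) := E.toFinset
  have hF : (F : Set (Sym2 V)) = E := by simp [F]
  have hD : (D : Set (Sym2 V)) = Sym2.diagSetᶜ := by simp [D]
  have hFD : F ⊆ D := by rwa [← Finset.coe_subset, hF, hD]
  have hcard : (Nat.card V).choose 2 = D.card := by
    rw [← Sym2.ncard_diagSet_compl, ← hD, Set.ncard_coe_finset]
  have hreal : ∀ G : SimpleGraph V, (SimpleGraph.binomialRandom V p).real {G} =
      (p : ℝ) ^ G.edgeSet.ncard * (1 - p : ℝ) ^ (D.card - G.edgeSet.ncard) := by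
    intro G
    rw [MeasureTheory.measureReal_def, SimpleGraph.binomialRandom_singleton, hcard]
    simp
  have hsum := Finset.sum_pow_mul_eq_add_pow (p : ℝ) (1 - p : ℝ) (D \ F)
  rw [add_sub_cancel, one_pow] at hsum
  simp only [mul_ite, mul_one, mul_zero]
  rw [← Finset.sum_filter, ← mul_one (_ ^ _), ← hsum, Finset.mul_sum]
  have hset : ∀ t ∈ (D \ F).powerset,
      (SimpleGraph.fromEdgeSet (E ∪ t : Set (Sym2 V))).edgeSet = E ∪ t := by
    intro t ht
    rw [SimpleGraph.edgeSet_fromEdgeSet, sdiff_eq_left, ← Set.subset_compl_iff_disjoint_right]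
    refine Set.union_subset hE fun e he => ?_
    rw [← hD]
    exact (Finset.mem_sdiff.1 (Finset.mem_powerset.1 ht he)).1
  refine Finset.sum_bij' (fun G _ => G.edgeSet.toFinset \ F)
    (fun t _ => SimpleGraph.fromEdgeSet (E ∪ t)) ?_ ?_ ?_ ?_ ?_
  · intro G _
    rw [Finset.mem_powerset]
    refine Finset.sdiff_subset_sdiff ?_ subset_rfl
    rw [← Finset.coe_subset, hD, Set.coe_toFinset]
    exact G.edgeSet_subset_compl_diagSet
  · intro t ht
    rw [Finset.mem_filter_univ, hset t ht]
    exact Set.subset_union_left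
  · intro G hG
    rw [Finset.mem_filter_univ] at hG
    rw [Finset.coe_sdiff, hF, Set.coe_toFinset, Set.union_sdiff_cancel hG,
      SimpleGraph.fromEdgeSet_edgeSet]
  · intro t ht
    rw [← Finset.coe_inj, Finset.coe_sdiff, hF, Set.coe_toFinset, hset t ht,
      Set.union_sdiff_cancel_left]
    rintro e ⟨h1, h2⟩
    exact (Finset.mem_sdiff.1 (Finset.mem_powerset.1 ht h2)).2 (by rwa [← Finset.mem_coe, hF])
  · intro G hG
    rw [Finset.mem_filter_univ] at hG
    have h1 : G.edgeSet.ncard = F.card + (G.edgeSet.toFinset \ F).card := by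
      rw [← Set.ncard_coe_finset, ← Set.ncard_coe_finset, Finset.coe_sdiff, hF, Set.coe_toFinset,
        ← Set.ncard_sdiff_add_ncard_of_subset hG, add_comm]
    rw [hreal, h1, Finset.card_sdiff_of_subset hFD, pow_add, Nat.sub_add_eq, mul_assoc,
      ← Set.ncard_coe_finset F, hF]

theorem wordEdges_subset_compl_diagSet {V : Type} {k : ℕ} {l : List V} (hl : l ∈ closedWords V k) :
    wordEdges l ⊆ Sym2.diagSetᶜ := by
  intro e he
  obtain ⟨a, b, -, -, h, rfl⟩ := exists_rel_of_mem_wordEdges hl.2.1 he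
  simpa using h

theorem randomMoment_eq_sum (p : ℚ⟦X⟧) (c : ℝ) (n k : ℕ) :
    randomMoment p c n k = ((c * evalReal p (1 / c)) ^ (-(1 / 2) : ℝ)) ^ k / n *
      ∑ l ∈ (finite_closedWords (V := Fin n) k).toFinset,
        (edgeProb c n : ℝ) ^ (wordEdges l).ncard := by
  classical
  simp only [randomMoment, spectralMoment_eq_sum]
  simp_rw [mul_left_comm _ (_ / _ : ℝ)]
  rw [← Finset.mul_sum]
  congr 1
  simp_rw [Finset.mul_sum]
  rw [Finset.sum_comm]
  refine Finset.sum_congr rfl fun l hl => ?_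
  rw [Set.Finite.mem_toFinset] at hl
  exact sum_binomialRandom_mul_indicator _ (wordEdges_subset_compl_diagSet hl)

theorem wordEdges_map {V V' : Type} (f : V → V') (l : List V) :
    wordEdges (l.map f) = Sym2.map f '' wordEdges l := by
  have h : List.zipWith (s(·, ·)) (l.map f) (l.map f).tail =
      (List.zipWith (s(·, ·)) l l.tail).map (Sym2.map f) := by
    rw [← List.map_tail, List.zipWith_map, List.map_zipWith]
    rfl
  ext e
  simp only [wordEdges, h, List.mem_map, Set.mem_image, Set.mem_ofPred]

theorem ncard_wordEdges_map {V V' : Type} {f : V → V'} (hf : Function.Injective f) (l : List V) :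
    (wordEdges (l.map f)).ncard = (wordEdges l).ncard := by
  rw [wordEdges_map, Set.ncard_image_of_injective _ (Sym2.map.injective hf)]

theorem map_mem_closedWords_iff {V V' : Type} {f : V → V'} (hf : Function.Injective f) {k : ℕ}
    {l : List V} : l.map f ∈ closedWords V' k ↔ l ∈ closedWords V k := by
  have h : (l.map f).head? = (l.map f).getLast? ↔ l.head? = l.getLast? := by
    rw [List.head?_map, List.getLast?_map, (Option.map_injective hf).eq_iff]
  simp only [closedWords, Set.mem_ofPred, List.length_map, List.isChain_map, hf.ne_iff, h]

theorem ncard_wordEdges_le {V : Type} {k : ℕ} {l : List V} (hl : l ∈ closedWords V k) :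
    (wordEdges l).ncard ≤ k := by
  classical
  have h : wordEdges l = ↑(List.zipWith (s(·, ·)) l l.tail).toFinset := by
    ext e
    simp [wordEdges]
  rw [h, Set.ncard_coe_finset]
  refine (List.toFinset_card_le _).trans ?_
  simp [hl.1]

theorem ncard_closedWords_toFinset_eq {n k m e : ℕ} {S : Finset (Fin n)} (hS : S.card = m) :
    {l | l ∈ closedWords (Fin n) k ∧ l.toFinset = S ∧ (wordEdges l).ncard = e}.ncard =
      (spanningWords (Fin m) k e).ncard := by
  have hinj : Function.Injective (S.orderEmbOfFin hS) := (S.orderEmbOfFin hS).injective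
  symm
  refine Set.ncard_congr (fun l _ => l.map (S.orderEmbOfFin hS)) ?_ ?_ ?_
  · rintro l ⟨h1, h2, h3⟩
    refine ⟨(map_mem_closedWords_iff hinj).2 h1, ?_, by rwa [ncard_wordEdges_map hinj]⟩
    ext y
    rw [List.mem_toFinset, List.mem_map, ← Finset.mem_coe, ← Finset.range_orderEmbOfFin S hS,
      Set.mem_range]
    simp only [h2, true_and]
  · intro l l' _ _ h
    exact hinj.list_map h
  · rintro l ⟨h1, h2, h3⟩
    obtain ⟨l, rfl⟩ : l ∈ Set.range (List.map (S.orderEmbOfFin hS)) := by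
      rw [Set.range_list_map, Set.mem_ofPred]
      intro x hx
      rw [Finset.range_orderEmbOfFin, ← h2]
      simpa using hx
    refine ⟨l, ⟨(map_mem_closedWords_iff hinj).1 h1, fun x => ?_, ?_⟩, rfl⟩
    · exact (List.mem_map_of_injective hinj).1
        (List.mem_toFinset.1 (h2.symm ▸ Finset.orderEmbOfFin_mem S hS x))
    · rwa [ncard_wordEdges_map hinj] at h3

theorem ncard_closedWords_card_eq (n k m e : ℕ) :
    {l | l ∈ closedWords (Fin n) k ∧ l.toFinset.card = m ∧ (wordEdges l).ncard = e}.ncard =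
      n.choose m * (spanningWords (Fin m) k e).ncard := by
  rw [ncard_eq_sum_ncard_fiber ((finite_closedWords _).subset fun _ h => h.1)
    (fun l : List (Fin n) => l.toFinset) (Finset.powersetCard m Finset.univ)
    (fun l hl => Finset.mem_powersetCard_univ.2 hl.2.1),
    Finset.sum_congr rfl (g := fun _ => (spanningWords (Fin m) k e).ncard)]
  · simp
  intro S hS
  rw [Finset.mem_powersetCard_univ] at hS
  rw [← ncard_closedWords_toFinset_eq hS]
  congr 1
  ext l
  simp only [Set.mem_ofPred]
  constructor
  · rintro ⟨⟨h1, h2, h3⟩, h4⟩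
    exact ⟨h1, h4, h3⟩
  · rintro ⟨h1, h2, h3⟩
    exact ⟨⟨h1, h2 ▸ hS, h3⟩, h2⟩

theorem sum_pow_ncard_wordEdges (n k : ℕ) (x : ℝ) :
    ∑ l ∈ (finite_closedWords (V := Fin n) k).toFinset, x ^ (wordEdges l).ncard =
      ∑ m ∈ Finset.range (k + 2), ∑ e ∈ Finset.range (k + 1),
        (n.choose m : ℝ) * (spanningWords (Fin m) k e).ncard * x ^ e := by
  have hmaps : ∀ l ∈ (finite_closedWords (V := Fin n) k).toFinset,
      (l.toFinset.card, (wordEdges l).ncard) ∈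
        Finset.range (k + 2) ×ˢ Finset.range (k + 1) := by
    intro l hl
    rw [Set.Finite.mem_toFinset] at hl
    have h := List.toFinset_card_le l
    rw [hl.1] at h
    exact Finset.mem_product.2 ⟨Finset.mem_range.2 (by omega),
      Finset.mem_range.2 (Nat.lt_succ_of_le (ncard_wordEdges_le hl))⟩
  rw [← Finset.sum_fiberwise_of_maps_to hmaps, Finset.sum_product]
  refine Finset.sum_congr rfl fun m _ => Finset.sum_congr rfl fun e _ => ?_
  rw [← Nat.cast_mul, ← ncard_closedWords_card_eq, Finset.sum_congr rfl (g := fun _ => x ^ e)]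
  · rw [Finset.sum_const, nsmul_eq_mul, ← Set.ncard_coe_finset]
    congr 3
    ext l
    simp
  · intro l hl
    have h : (wordEdges l).ncard = e := (Prod.ext_iff.1 (Finset.mem_filter.1 hl).2).2
    rw [h]

theorem tendsto_choose_div_pow (m : ℕ) :
    Tendsto (fun n : ℕ => (n.choose m : ℝ) / (n : ℝ) ^ m) atTop (𝓝 (1 / m !)) := by
  have h : Asymptotics.IsEquivalent atTop (fun n : ℕ => (n.choose m : ℝ) / (n : ℝ) ^ m)
      fun n : ℕ => (n : ℝ) ^ m / m ! / (n : ℝ) ^ m :=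
    (isEquivalent_choose m).div Asymptotics.IsEquivalent.refl
  refine h.symm.tendsto_nhds (tendsto_const_nhds.congr' ?_)
  filter_upwards [eventually_gt_atTop 0] with n hn
  have : (n : ℝ) ≠ 0 := by exact_mod_cast hn.ne'
  field_simp

theorem tendsto_choose_div_pow_succ {m e : ℕ} (h : m ≤ e + 1) :
    Tendsto (fun n : ℕ => (n.choose m : ℝ) / (n : ℝ) ^ (e + 1)) atTop
      (𝓝 (if m = e + 1 then 1 / (m ! : ℝ) else 0)) := by
  split_ifs with hm
  · rw [← hm]
    exact tendsto_choose_div_pow m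
  · have h1 : Tendsto (fun n : ℕ => (n.choose m : ℝ) / (n : ℝ) ^ m * (1 / (n : ℝ) ^ (e + 1 - m)))
        atTop (𝓝 (1 / (m ! : ℝ) * 0)) :=
      (tendsto_choose_div_pow m).mul (tendsto_const_nhds.div_atTop
        ((tendsto_pow_atTop (by omega)).comp tendsto_natCast_atTop_atTop))
    rw [mul_zero] at h1
    refine h1.congr fun n => ?_
    rw [div_mul_div_comm, mul_one, ← pow_add, Nat.add_sub_cancel' h]

theorem edgeProb_eq {c : ℝ} (hc : 0 ≤ c) {n : ℕ} (hn : c ≤ n) : (edgeProb c n : ℝ) = c / n := by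
  rw [edgeProb, Set.projIcc_of_mem]
  exact ⟨by positivity, div_le_one_of_le₀ hn (by positivity)⟩

/-- Words with `m` vertices and `e` edges contribute at order `n^(m - e - 1)`. Connectedness forces
`m ≤ e + 1`, with equality exactly for trees. -/
theorem tendsto_randomMoment (p : ℚ⟦X⟧) {c : ℝ} (hc : 0 ≤ c) (k : ℕ) :
    Tendsto (fun n => randomMoment p c n k) atTop
      (𝓝 (((c * evalReal p (1 / c)) ^ (-(1 / 2) : ℝ)) ^ k *
        ∑ e ∈ Finset.range (k + 1), numTreeWalks (e + 1) k * c ^ e / (e + 1)!)) := by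
  set s : ℝ := (c * evalReal p (1 / c)) ^ (-(1 / 2) : ℝ)
  have hterm : ∀ m e : ℕ, Tendsto (fun n : ℕ => (n.choose m : ℝ) / (n : ℝ) ^ (e + 1) *
      ((spanningWords (Fin m) k e).ncard * c ^ e)) atTop
      (𝓝 (if m = e + 1 then numTreeWalks (e + 1) k * c ^ e / (e + 1)! else 0)) := by
    intro m e
    by_cases hm : m ≤ e + 1
    · have h := (tendsto_choose_div_pow_succ hm).mul_const
        ((spanningWords (Fin m) k e).ncard * c ^ e)
      convert h using 2
      split_ifs with h1
      · subst h1
        rw [numTreeWalks_eq_ncard]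
        ring
      · ring
    · have h0 : spanningWords (Fin m) k e = ∅ := by
        refine Set.eq_empty_of_forall_notMem fun l hl => ?_
        have := card_le_ncard_wordEdges hl
        rw [Nat.card_fin] at this
        omega
      rw [if_neg (by omega), h0]
      simp
  have hsum : Tendsto (fun n : ℕ => s ^ k * ∑ m ∈ Finset.range (k + 2),
      ∑ e ∈ Finset.range (k + 1), (n.choose m : ℝ) / (n : ℝ) ^ (e + 1) *
      ((spanningWords (Fin m) k e).ncard * c ^ e)) atTop
      (𝓝 (s ^ k * ∑ m ∈ Finset.range (k + 2), ∑ e ∈ Finset.range (k + 1),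
        if m = e + 1 then numTreeWalks (e + 1) k * c ^ e / (e + 1)! else 0)) :=
    (tendsto_finsetSum _ fun m _ => tendsto_finsetSum _ fun e _ => hterm m e).const_mul _
  rw [Finset.sum_comm] at hsum
  have hlim : ∑ e ∈ Finset.range (k + 1), ∑ m ∈ Finset.range (k + 2),
      (if m = e + 1 then (numTreeWalks (e + 1) k * c ^ e / (e + 1)! : ℝ) else 0) =
      ∑ e ∈ Finset.range (k + 1), numTreeWalks (e + 1) k * c ^ e / (e + 1)! := by
    refine Finset.sum_congr rfl fun e he => ?_
    rw [Finset.sum_ite_eq' _ (e + 1), if_pos]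
    rw [Finset.mem_range] at he ⊢
    omega
  rw [hlim] at hsum
  refine hsum.congr' ?_
  -- For `n ≥ c` the clamping in `edgeProb` has no effect.
  filter_upwards [tendsto_natCast_atTop_atTop.eventually_ge_atTop c] with n hn
  rw [randomMoment_eq_sum, sum_pow_ncard_wordEdges, edgeProb_eq hc hn, div_mul_eq_mul_div,
    mul_div_assoc, Finset.sum_div]
  congr 1
  refine Finset.sum_congr rfl fun m _ => ?_
  rw [Finset.sum_div]
  refine Finset.sum_congr rfl fun e _ => ?_
  rw [div_pow, pow_succ]
  field_simp

theorem evalReal_geomScaling {x : ℝ} (h0 : 0 ≤ x) (h1 : x < 1) :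
    evalReal geomScaling x = (1 - x)⁻¹ := by
  simp [evalReal, geomScaling, tsum_geometric_of_lt_one h0 h1]

/-- The coefficient of `z ^ l` in `M_{μ ^ p}(√z)`, as a polynomial in `1 / c`. -/
def momentPoly (l : ℕ) : ℚ[X] :=
  (1 - Polynomial.X) ^ l *
    ∑ e ∈ Finset.range (l + 1), Polynomial.monomial (l - e) (walkCount 1 e l)

theorem coeff_coeffGF (i l : ℕ) :
    PowerSeries.coeff l (coeffGF geomScaling i) = (momentPoly l).coeff i := by
  have h : (∑ e ∈ Finset.range (l + 1), Polynomial.monomial (l - e) (walkCount 1 e l) : ℚ[X]) =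
      PowerSeries.coeff l momentGF := by
    symm
    rw [momentGF, PowerSeries.coeff_mk, formalMoment, Finset.sum_range_succ', numTreeWalks_zero]
    simp only [numTreeWalks_div_factorial, Nat.add_sub_add_right, Nat.cast_zero, zero_div,
      map_zero, add_zero]
    ext j
    simp [Polynomial.coeff_monomial, PowerSeries.coeff_monomial, eq_comm]
  rw [coeffGF, PowerSeries.coeff_mk, scaledMomentGF, geomScaling_inv, PowerSeries.coeff_rescale,
    ← Polynomial.coeff_coe, momentPoly, Polynomial.coe_mul, h]
  simp

theorem hasSum_coeff_coeffGF (l : ℕ) (x : ℝ) :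
    HasSum (fun i => ((PowerSeries.coeff l (coeffGF geomScaling i) : ℚ) : ℝ) * x ^ i)
      (Polynomial.aeval x (momentPoly l)) := by
  rw [Polynomial.aeval_eq_sum_range]
  simp only [coeff_coeffGF, Algebra.smul_def, eq_ratCast]
  refine hasSum_sum_of_ne_finset_zero fun i hi => ?_
  rw [Finset.mem_range, not_lt, Nat.add_one_le_iff] at hi
  rw [Polynomial.coeff_eq_zero_of_natDegree_lt hi, Rat.cast_zero, zero_mul]

theorem aeval_momentPoly {c : ℝ} (hc : c ≠ 0) (l : ℕ) :
    Polynomial.aeval (1 / c) (momentPoly l) =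
      ((1 - 1 / c) / c) ^ l * ∑ e ∈ Finset.range (l + 1), (walkCount 1 e l : ℝ) * c ^ e := by
  rw [momentPoly, map_mul, map_sum, div_pow, div_mul_eq_mul_div, mul_div_assoc, Finset.sum_div]
  congr 1
  · simp
  · refine Finset.sum_congr rfl fun e he => ?_
    have h : e ≤ l := Nat.lt_succ_iff.1 (Finset.mem_range.1 he)
    obtain ⟨d, rfl⟩ := Nat.exists_eq_add_of_le h
    rw [Polynomial.aeval_monomial, Nat.add_sub_cancel_left, one_div, inv_pow, pow_add]
    simp only [eq_ratCast]
    field_simp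

theorem tendsto_randomMoment_even {c : ℝ} (hc : 1 < c) (l : ℕ) :
    Tendsto (fun n => randomMoment geomScaling c n (2 * l)) atTop
      (𝓝 (Polynomial.aeval (1 / c) (momentPoly l))) := by
  have hc0 : 0 < c := one_pos.trans hc
  have h1 : 1 / c < 1 := (div_lt_one hc0).2 hc
  have hscale : ((c * evalReal geomScaling (1 / c)) ^ (-(1 / 2) : ℝ)) ^ (2 * l) =
      ((1 - 1 / c) / c) ^ l := by
    have h2 : (1 - 1 / c) / c = (c * (1 - 1 / c)⁻¹)⁻¹ := by rw [mul_inv, inv_inv, div_eq_inv_mul]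
    rw [evalReal_geomScaling (by positivity) h1, pow_mul, ← Real.rpow_mul_natCast, h2,
      ← Real.rpow_neg_one (c * _)]
    · congr 2
      norm_num
    · have := sub_pos.2 h1
      positivity
  have hterm : ∀ e : ℕ, (numTreeWalks (e + 1) (2 * l) * c ^ e / (e + 1)! : ℝ) =
      (walkCount 1 e l : ℝ) * c ^ e := by
    intro e
    rw [← numTreeWalks_div_factorial]
    push_cast
    ring
  -- A tree walk of length `2 * l` has at most `l` edges.
  have hsum : ∑ e ∈ Finset.range (2 * l + 1), (walkCount 1 e l : ℝ) * c ^ e =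
      ∑ e ∈ Finset.range (l + 1), (walkCount 1 e l : ℝ) * c ^ e := by
    refine (Finset.sum_subset (Finset.range_subset_range.2 (by omega)) fun e _ he => ?_).symm
    rw [Finset.mem_range, not_lt, Nat.add_one_le_iff] at he
    rw [walkCount_eq_zero he, Rat.cast_zero, zero_mul]
  have h := tendsto_randomMoment geomScaling hc0.le (2 * l)
  simp only [hterm, hsum, hscale] at h
  rwa [aeval_momentPoly hc0.ne']

theorem tendsto_randomMoment_odd {c : ℝ} (hc : 1 < c) (l : ℕ) :
    Tendsto (fun n => randomMoment geomScaling c n (2 * l + 1)) atTop (𝓝 0) := by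
  simpa [numTreeWalks_odd] using tendsto_randomMoment geomScaling (zero_le_one.trans hc.le)
    (2 * l + 1)

end TreeWalk

end

theorem theorem3 :
    -- for every real `c > 1`, the series `∑ᵢ c⁻ⁱ V̂ᵢ(z)` is the generating function of the
    -- even moments of the limit `μ ^ p` of `μ_n ^ p`, whose odd moments vanish
    (∀ c : ℝ, 1 < c → ∀ l : ℕ,
      (∃ L : ℝ,
        Tendsto (fun n : ℕ => TreeWalk.randomMoment TreeWalk.geomScaling c n (2 * l))
          atTop (𝓝 L) ∧
        HasSum (fun i : ℕ =>
          ((PowerSeries.coeff l (TreeWalk.coeffGF TreeWalk.geomScaling i) : ℚ) : ℝ) * (1 / c) ^ i) L) ∧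
      Tendsto (fun n : ℕ => TreeWalk.randomMoment TreeWalk.geomScaling c n (2 * l + 1))
        atTop (𝓝 0)) ∧
    -- `V̂ᵢ` for `i = 0, 1, 2`
    (∀ i : ℕ, i ≤ 2 → ∃ Q : ℚ[X],
      TreeWalk.coeffGF TreeWalk.geomScaling i =
        TreeWalk.catGF * Polynomial.aeval TreeWalk.zCsq Q) ∧
    -- `V̂ᵢ` for `i ≥ 3`; the series `1 - z C(z) ^ 2` has constant term `1`, hence is invertible
    (∀ i : ℕ, 3 ≤ i → ∃ Q : ℚ[X],
      TreeWalk.coeffGF TreeWalk.geomScaling i =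
        TreeWalk.catGF * Polynomial.aeval TreeWalk.zCsq Q *
          ((1 - TreeWalk.zCsq) ^ (2 * i - 3))⁻¹) := by
  refine ⟨fun c hc l => ⟨⟨_, TreeWalk.tendsto_randomMoment_even hc l,
    TreeWalk.hasSum_coeff_coeffGF l (1 / c)⟩, TreeWalk.tendsto_randomMoment_odd hc l⟩,
    fun i hi => TreeWalk.coeffGF_of_le_two hi, fun i hi => TreeWalk.coeffGF_of_three_le hi⟩
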